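/- Let $\mathbb D=\{z\in\mathbb C:|z|<1\}$, let $dm$ be Lebesgue area measure on $\mathbb D$ normalized so that $m(\mathbb D)=1$, and let $\varphi_a(z)=\frac{a-z}{1-\bar a z}$ for $a\in\mathbb D$. For $q>0$ and $f$ analytic in $\mathbb D$ put $$\|f\|_{\mathcal D_q}^2=|f(0)|^2+\int_{\mathbb D}|f'(z)|^2(1-|z|^2)^q\,dm(z),$$ and let $\mathcal D_q$ be the space of analytic $f$ with $\|f\|_{\mathcal D_q}<\infty$. Let $\mathcal Q_q$ be the space of $f\in\mathcal D_q$ with $\|f\|_{\mathcal Q_q}=|f(0)|+\sup_{a\in\mathbb D}\|f\circ\varphi_a-f(a)\|_{\mathcal D_q}<\infty$. For $0<p,\lambda<1$ let $\mathcal D_p^\lambda$ be the Dirichlet–Morrey space of analytic $f$ in $\mathbb D$ with $$\|f\|_{\mathcal D_p^\lambda}=|f(0)|+\sup_{a\in\mathbb D}(1-|a|^2)^{\frac p2(1-\lambda)}\|f\circ\varphi_a-f(a)\|_{\mathcal D_p}<\infty .$$ Let $\mathcal W_p$ be the space of analytic $g$ in $\mathbb D$ for which $d\mu_g(z)=|g'(z)|^2(1-|z|^2)^p\,dm(z)$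 is a $\mathcal D_p$-Carleson measure, i.e. there is a constant $C<\infty$ with $\int_{\mathbb D}|f|^2\,d\mu_g\le C\|f\|_{\mathcal D_p}^2$ for all $f\in\mathcal D_p$. Let $H^\infty$ be the space of bounded analytic functions in $\mathbb D$, and write $M_g(f)=gf$. **Corollary 3.5.** Let $0<p,\lambda<1$ and let $g$ be analytic in $\mathbb D$. 1. If $g\in\mathcal W_p\cap H^\infty$, then $M_g:\mathcal D_p^\lambda\to\mathcal D_p^\lambda$ is bounded. 2. If $g\in\mathcal Q_{p\lambda}\cap H^\infty$, then $M_g:\mathcal D_p^\lambda\to\mathcal D_p^\lambda$ is bounded. 3. If $M_g:\mathcal D_p^\lambda\to\mathcal D_p^\lambda$ is bounded, then $g\in\mathcal Q_p\cap H^\infty$. -/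

import Mathlib

open MeasureTheory Metric
open scoped NNReal ENNReal

namespace DirichletMorrey

noncomputable section

/-- The open unit disc of `ℂ`. Analytic functions on the disc are represented by functions
`f : ℂ → ℂ` with `DifferentiableOn ℂ f disc`; their values off the disc are never used. -/
def disc : Set ℂ := ball 0 1

/-- Planar Lebesgue measure on the disc, normalized to have total mass one. -/
def areaMeasure : Measure ℂ := ENNReal.ofReal (1 / Real.pi) • (volume.restrict disc)

/-- The automorphism `φ_a(z) = (a - z) / (1 - conj a * z)` of the disc, for `a` in the disc. -/
def phi (a z : ℂ) : ℂ := (a - z) / (1 - (starRingEnd ℂ) a * z)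

/-- The hyperbolic translate `f ∘ φ_a - f(a)`. -/
def hypTranslate (f : ℂ → ℂ) (a : ℂ) : ℂ → ℂ := fun z => f (phi a z) - f a

/-- The measure `|f'(z)|² (1 - |z|²)^p dm(z)` on the disc. -/
def dirichletMeasure (p : ℝ) (f : ℂ → ℂ) : Measure ℂ :=
  areaMeasure.withDensity
    (fun z => ‖deriv f z‖ₑ ^ 2 * ENNReal.ofReal ((1 - ‖z‖ ^ 2) ^ p))

/-- The norm of the weighted Dirichlet space,
`‖f‖² = |f(0)|² + ∫ |f'(z)|² (1 - |z|²)^p dm(z)`, with values in `[0, ∞]`. -/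
def dirichletNorm (p : ℝ) (f : ℂ → ℂ) : ℝ≥0∞ :=
  (‖f 0‖ₑ ^ 2 +
    ∫⁻ z, ‖deriv f z‖ₑ ^ 2 * ENNReal.ofReal ((1 - ‖z‖ ^ 2) ^ p) ∂areaMeasure) ^ (1 / 2 : ℝ)

/-- The weighted Dirichlet space `𝒟_p`. -/
def dirichletSpace (p : ℝ) : Set (ℂ → ℂ) :=
  {f | DifferentiableOn ℂ f disc ∧ dirichletNorm p f < ∞}

/-- The norm of `𝒬_p`: `|f(0)| + sup_a ‖f ∘ φ_a - f(a)‖_{𝒟_p}`. -/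
def qNorm (p : ℝ) (f : ℂ → ℂ) : ℝ≥0∞ :=
  ‖f 0‖ₑ + ⨆ a ∈ disc, dirichletNorm p (hypTranslate f a)

/-- The Möbius invariant space `𝒬_p`: the `f ∈ 𝒟_p` whose hyperbolic translates form a
bounded set in `𝒟_p`. -/
def qSpace (p : ℝ) : Set (ℂ → ℂ) :=
  {f | f ∈ dirichletSpace p ∧ qNorm p f < ∞}

/-- The norm of the Dirichlet-Morrey space,
`|f(0)| + sup_a (1 - |a|²)^{(p/2)(1-l)} ‖f ∘ φ_a - f(a)‖_{𝒟_p}`. -/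
def morreyNorm (p l : ℝ) (f : ℂ → ℂ) : ℝ≥0∞ :=
  ‖f 0‖ₑ + ⨆ a ∈ disc,
    ENNReal.ofReal ((1 - ‖a‖ ^ 2) ^ (p / 2 * (1 - l))) * dirichletNorm p (hypTranslate f a)

/-- The Dirichlet-Morrey space `𝒟_p^l`. -/
def morreySpace (p l : ℝ) : Set (ℂ → ℂ) :=
  {f | DifferentiableOn ℂ f disc ∧ morreyNorm p l f < ∞}

/-- A measure on the disc is `𝒟_p`-Carleson if `∫ |f|² dμ ≤ C ‖f‖²` for all `f ∈ 𝒟_p`, with a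
finite constant `C` independent of `f`. -/
def IsDirichletCarleson (p : ℝ) (μ : Measure ℂ) : Prop :=
  ∃ C : ℝ≥0, ∀ f ∈ dirichletSpace p,
    ∫⁻ z in disc, ‖f z‖ₑ ^ 2 ∂μ ≤ C * dirichletNorm p f ^ 2

/-- The space `𝒲_p`: the analytic `g` for which `|g'(z)|² (1 - |z|²)^p dm(z)` is a
`𝒟_p`-Carleson measure. -/
def wSpace (p : ℝ) : Set (ℂ → ℂ) :=
  {g | DifferentiableOn ℂ g disc ∧ IsDirichletCarleson p (dirichletMeasure p g)}

/-- The space `H^∞` of bounded analytic functions on the disc. -/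
def hInfty : Set (ℂ → ℂ) :=
  {g | DifferentiableOn ℂ g disc ∧ ∃ C : ℝ, ∀ z ∈ disc, ‖g z‖ ≤ C}

/-- The multiplication operator `M_g f = g f`. -/
def mulOp (g f : ℂ → ℂ) : ℂ → ℂ := fun z => g z * f z

/-- `M_g` maps `𝒟_p^l` into itself and is bounded there. -/
def IsBoundedMul (p l : ℝ) (g : ℂ → ℂ) : Prop :=
  (∀ f ∈ morreySpace p l, mulOp g f ∈ morreySpace p l) ∧
    ∃ C : ℝ≥0, ∀ f ∈ morreySpace p l, morreyNorm p l (mulOp g f) ≤ C * morreyNorm p l f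

end

end DirichletMorrey

/-!
Throughout, `σ = p (1 - l) / 2`, `energy p f a = ∫ |f'|² (1 - |φ_a|²)^p dm`, and `‖f‖` is the
Dirichlet-Morrey norm. The change of variables `w = φ_a(z)` shows that `energy p f a` is the square
of the `𝒟_p` norm of `f ∘ φ_a - f(a)`, so that `f` is a Morrey function exactly when
`(1 - |a|²)^(2σ) energy p f a` is bounded in `a`.

The analytic input is Hardy's inequality in the form `lintegral_sq_div_le`:
`∫ |h|² (1 - |z|²)^p |1 - conj a * z|⁻² dm ≤ C ‖h‖²_{𝒟_p}` with `C` independent of `a`. By Parseval's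
formula for the weight `(1 - |z|²)^p` it becomes an inequality for Taylor coefficients, proved by
summation by parts. After `w = φ_a(z)` it says that multiplication by
`(1 - |a|²)^(p/2) (1 - conj a * w)^(-p)` takes the Möbius-invariant energy at `a` back to the norm of
`𝒟_p` (`dirichletNorm_mul_cauchyPow_le`). The other input is the growth estimate
`|f(a)| ≤ C (1 - |a|²)^(-σ) ‖f‖` (`exists_norm_le_morreyNorm`).

Since `(g f)' = g f' + g' f`, for bounded `g` it is enough to bound
`crossEnergy p f g a = ∫ |f|² |g'|² (1 - |φ_a|²)^p dm` by `C (1 - |a|²)^(-2σ) ‖f‖²`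
(`isBoundedMul_of_crossEnergy_le`).
* If `g ∈ 𝒲_p`, apply the Carleson inequality to `f (1 - conj a * w)^(-p)`.
* If `g ∈ 𝒬_{pl}`, insert the growth of `f` and `(1 - |a|²)(1 - |φ_a(w)|²) ≤ 4 (1 - |w|²)`.

Conversely, let `M_g` be bounded. Applying point evaluations to `g ^ n = M_g ^ n 1` gives `g ∈ H^∞`.
The functions `(1 - conj a * w)^(-σ)` are bounded in the Morrey space uniformly in `a`
(`exists_morreyNorm_cauchyPow_le`, again by Hardy's inequality). Testing `M_g` on them bounds the
integrals of `(1 - |a|²)^(p+2σ) |1 - conj a * w|^(-2p-2σ)` against the measure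
`|g'|² (1 - |w|²)^p dm`. Membership in `𝒬_p` asks for the kernel with exponent `2p` instead, which is
dominated by a geometrically weighted sum of those kernels at points approaching the centre along a
radius (`exists_kernel_le`).
-/

namespace DirichletMorrey

open Filter Topology

/-! ### Parseval's formula in weighted Bergman spaces -/

lemma mem_disc {z : ℂ} : z ∈ disc ↔ ‖z‖ < 1 := by simp [disc]

lemma isOpen_disc : IsOpen disc := isOpen_ball

lemma zero_mem_disc : (0 : ℂ) ∈ disc := by simp [disc]

lemma measurableSet_disc : MeasurableSet disc := isOpen_disc.measurableSet

lemma lintegral_area (F : ℂ → ℝ≥0∞) :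
    ∫⁻ z, F z ∂areaMeasure = ENNReal.ofReal (1 / Real.pi) * ∫⁻ z in disc, F z := by
  simp [areaMeasure]

lemma ae_mem_disc : ∀ᵐ z ∂areaMeasure, z ∈ disc :=
  Measure.ae_smul_measure (ae_restrict_mem measurableSet_disc) _

lemma area_mono {F G : ℂ → ℝ≥0∞} (h : ∀ z ∈ disc, F z ≤ G z) :
    ∫⁻ z, F z ∂areaMeasure ≤ ∫⁻ z, G z ∂areaMeasure :=
  lintegral_mono_ae (ae_mem_disc.mono h)

lemma area_congr {F G : ℂ → ℝ≥0∞} (h : ∀ z ∈ disc, F z = G z) :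
    ∫⁻ z, F z ∂areaMeasure = ∫⁻ z, G z ∂areaMeasure :=
  lintegral_congr_ae (ae_mem_disc.mono h)

lemma measurable_indicator_disc {u : ℂ → ℂ} (hu : ContinuousOn u disc) :
    Measurable (disc.indicator u) := by
  classical
  rw [← Set.piecewise_eq_indicator]
  exact hu.measurable_piecewise continuousOn_const measurableSet_disc

/-- Integration over the disc in polar coordinates. -/
lemma lintegral_area_polar {G : ℂ → ℝ≥0∞} (hG : Measurable (disc.indicator G)) :
    ∫⁻ z, G z ∂areaMeasure = ENNReal.ofReal (1 / Real.pi) *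
      ∫⁻ r in Set.Ioo (0 : ℝ) 1, ENNReal.ofReal r *
        ∫⁻ θ in Set.Ioo (-Real.pi) Real.pi, G (circleMap 0 r θ) := by
  rw [lintegral_area, ← lintegral_indicator measurableSet_disc,
    ← Complex.lintegral_comp_polarCoord_symm]
  congr 1
  have hpol : ∀ q : ℝ × ℝ, Complex.polarCoord.symm q = circleMap 0 q.1 q.2 := by
    intro q
    simp [Complex.polarCoord_symm_apply, circleMap, Complex.exp_mul_I]
  simp_rw [hpol, smul_eq_mul]
  have hmeas : Measurable fun q : ℝ × ℝ => ENNReal.ofReal q.1 *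
      disc.indicator G (circleMap 0 q.1 q.2) := by
    refine (ENNReal.measurable_ofReal.comp measurable_fst).mul (hG.comp ?_)
    have : Continuous fun q : ℝ × ℝ => circleMap 0 q.1 q.2 := by
      unfold circleMap; fun_prop
    exact this.measurable
  rw [show polarCoord.target = Set.Ioi (0 : ℝ) ×ˢ Set.Ioo (-Real.pi) Real.pi from rfl,
    Measure.volume_eq_prod, ← Measure.prod_restrict, lintegral_prod _ hmeas.aemeasurable,
    ← lintegral_indicator measurableSet_Ioi, ← lintegral_indicator measurableSet_Ioo]
  refine lintegral_congr fun r => ?_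
  by_cases h0 : 0 < r
  · by_cases h1 : r < 1
    · rw [Set.indicator_of_mem (Set.mem_Ioi.2 h0), Set.indicator_of_mem (Set.mem_Ioo.2 ⟨h0, h1⟩),
        ← lintegral_const_mul' _ _ ENNReal.ofReal_ne_top]
      refine lintegral_congr fun θ => ?_
      rw [Set.indicator_of_mem]
      simp [mem_disc, abs_of_pos h0, h1]
    · rw [Set.indicator_of_mem (Set.mem_Ioi.2 h0), Set.indicator_of_notMem (by simp [h1])]
      simp [mem_disc, abs_of_pos h0, h1]
  · rw [Set.indicator_of_notMem (by simpa using h0), Set.indicator_of_notMem (by simp [h0])]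

/-- Parseval's formula on a circle, for a power series that converges absolutely there. -/
lemma hasSum_sq_circleAverage {c : ℕ → ℂ} {u : ℂ → ℂ} {r : ℝ} (hr : 0 < r)
    (hs : Summable fun n => ‖c n‖ * r ^ n)
    (hu : ∀ z : ℂ, ‖z‖ = r → HasSum (fun n => c n * z ^ n) (u z)) :
    HasSum (fun n => ‖c n‖ ^ 2 * r ^ (2 * n)) (Real.circleAverage (fun z => ‖u z‖ ^ 2) 0 r) := by
  have hnn : ∀ n, 0 ≤ ‖c n‖ ^ 2 * r ^ (2 * n) := fun n => by positivity
  rw [hasSum_iff_tendsto_nat_of_nonneg hnn]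
  set P : ℕ → Polynomial ℂ := fun N => ∑ n ∈ Finset.range N, Polynomial.monomial n (c n * r ^ n)
    with hP
  have hcoef : ∀ N n, (P N).coeff n = if n < N then c n * r ^ n else 0 := by
    intro N n
    simp [hP, Polynomial.finsetSum_coeff, Polynomial.coeff_monomial]
  have hpars : ∀ N, ∑ n ∈ Finset.range N, ‖c n‖ ^ 2 * r ^ (2 * n) =
      (2 * Real.pi)⁻¹ * ∫ θ in (0 : ℝ)..2 * Real.pi,
        ‖∑ n ∈ Finset.range N, c n * (circleMap 0 r θ) ^ n‖ ^ 2 := by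
    intro N
    have h1 := Polynomial.sum_sq_norm_coeff_eq_circleAverage (P N)
    rw [Finset.sum_subset (s₂ := Finset.range N)] at h1
    · rw [Real.circleAverage, smul_eq_mul] at h1
      convert h1 using 1
      · refine Finset.sum_congr rfl fun n hn => ?_
        rw [hcoef, if_pos (Finset.mem_range.1 hn), norm_mul, norm_pow, Complex.norm_real,
          Real.norm_of_nonneg hr.le]
        ring
      · congr 1
        refine intervalIntegral.integral_congr fun θ _ => ?_
        simp only [hP, Polynomial.eval_finsetSum, Polynomial.eval_monomial]
        congr 2
        refine Finset.sum_congr rfl fun n _ => ?_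
        simp [circleMap, mul_pow]
        ring
    · intro n hn
      rw [Finset.mem_range]
      by_contra h
      simp [hcoef, h] at hn
    · intro n _ hn
      simpa using hn
  simp_rw [hpars, Real.circleAverage, smul_eq_mul]
  refine Tendsto.const_mul _ ?_
  refine intervalIntegral.tendsto_integral_filter_of_dominated_convergence
    (fun _ => (∑' n, ‖c n‖ * r ^ n) ^ 2) ?_ ?_ ?_ ?_
  · refine Eventually.of_forall fun N => Continuous.aestronglyMeasurable ?_
    fun_prop
  · refine Eventually.of_forall fun N => Eventually.of_forall fun θ _ => ?_
    rw [Real.norm_of_nonneg (by positivity)]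
    gcongr
    calc ‖∑ n ∈ Finset.range N, c n * (circleMap 0 r θ) ^ n‖
        ≤ ∑ n ∈ Finset.range N, ‖c n‖ * r ^ n := by
          refine (norm_sum_le _ _).trans (Finset.sum_le_sum fun n _ => ?_)
          simp [abs_of_pos hr]
      _ ≤ _ := hs.sum_le_tsum _ fun n _ => by positivity
  · exact intervalIntegrable_const
  · refine Eventually.of_forall fun θ _ => ?_
    exact ((hu (circleMap 0 r θ) (by simp [abs_of_pos hr])).tendsto_sum_nat.norm).pow 2

/-- The moments of the weight `(1 - |z|²)^p`: the squared norm of `z ^ n` in the weighted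
Bergman space. -/
noncomputable def moment (p : ℝ) (n : ℕ) : ℝ :=
  ∫ r in (0 : ℝ)..1, 2 * r ^ (2 * n + 1) * (1 - r ^ 2) ^ p

lemma continuous_moment_integrand {p : ℝ} (hp : 0 < p) (n : ℕ) :
    Continuous fun r : ℝ => 2 * r ^ n * (1 - r ^ 2) ^ p := by
  have : Continuous fun r : ℝ => (1 - r ^ 2) ^ p :=
    Continuous.rpow_const (by fun_prop) fun _ => Or.inr hp.le
  fun_prop

lemma moment_nonneg (p : ℝ) (n : ℕ) : 0 ≤ moment p n := by
  refine intervalIntegral.integral_nonneg zero_le_one fun r hr => ?_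
  have : 0 ≤ 1 - r ^ 2 := by nlinarith [hr.1, hr.2]
  have := hr.1
  positivity

lemma moment_succ {p : ℝ} (hp : 0 < p) (n : ℕ) :
    (n + p + 2) * moment p (n + 1) = (n + 1) * moment p n := by
  have hder : ∀ r : ℝ, HasDerivAt (fun r : ℝ => r ^ (2 * n + 2) * (1 - r ^ 2) ^ (p + 1))
      (((n : ℝ) + 1) * (2 * r ^ (2 * n + 1) * (1 - r ^ 2) ^ (p + 1)) -
        (p + 1) * (2 * r ^ (2 * (n + 1) + 1) * (1 - r ^ 2) ^ p)) r := by
    intro r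
    have h1 : HasDerivAt (fun r : ℝ => (1 - r ^ 2) ^ (p + 1))
        (-(2 * r) * (p + 1) * (1 - r ^ 2) ^ p) r := by
      have h2 : HasDerivAt (fun r : ℝ => 1 - r ^ 2) (-(2 * r)) r := by
        simpa using (hasDerivAt_pow 2 r).const_sub 1
      have := h2.rpow_const (p := p + 1) (Or.inr (by linarith))
      simpa using this
    have h3 := (hasDerivAt_pow (2 * n + 2) r).mul h1
    refine h3.congr_deriv ?_
    rw [show 2 * n + 2 - 1 = 2 * n + 1 by omega]
    push_cast
    ring
  have hcont1 := continuous_moment_integrand (p := p + 1) (by linarith) (2 * n + 1)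
  have hcont2 := continuous_moment_integrand hp (2 * (n + 1) + 1)
  have hcont3 := continuous_moment_integrand hp (2 * n + 1)
  have hint := intervalIntegral.integral_eq_sub_of_hasDerivAt (a := 0) (b := 1)
    (fun r _ => hder r) (((hcont1.const_mul _).sub (hcont2.const_mul _)).intervalIntegrable 0 1)
  rw [intervalIntegral.integral_sub ((hcont1.const_mul _).intervalIntegrable 0 1)
    ((hcont2.const_mul _).intervalIntegrable 0 1), intervalIntegral.integral_const_mul,
    intervalIntegral.integral_const_mul] at hint
  have hsplit : ∫ r in (0 : ℝ)..1, 2 * r ^ (2 * n + 1) * (1 - r ^ 2) ^ (p + 1) =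
      moment p n - moment p (n + 1) := by
    rw [moment, moment, ← intervalIntegral.integral_sub (hcont3.intervalIntegrable 0 1)
      (hcont2.intervalIntegrable 0 1)]
    refine intervalIntegral.integral_congr fun r hr => ?_
    rw [Set.uIcc_of_le zero_le_one] at hr
    have : 0 ≤ 1 - r ^ 2 := by nlinarith [hr.1, hr.2]
    rw [Real.rpow_add_one' this (by linarith)]
    ring
  rw [hsplit] at hint
  have : (1 : ℝ) - 1 ^ 2 = 0 := by norm_num
  rw [this, Real.zero_rpow (by linarith)] at hint
  simp only [mul_zero, zero_mul, ne_eq, Nat.add_eq_zero_iff, OfNat.ofNat_ne_zero, and_false,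
    not_false_eq_true, zero_pow, sub_zero] at hint
  change _ - (p + 1) * moment p (n + 1) = 0 at hint
  linarith

lemma moment_zero {p : ℝ} (hp : 0 < p) : (p + 1) * moment p 0 = 1 := by
  have hder : ∀ r : ℝ, HasDerivAt (fun r : ℝ => -(1 - r ^ 2) ^ (p + 1))
      ((p + 1) * (2 * r ^ (2 * 0 + 1) * (1 - r ^ 2) ^ p)) r := by
    intro r
    have h2 : HasDerivAt (fun r : ℝ => 1 - r ^ 2) (-(2 * r)) r := by
      simpa using (hasDerivAt_pow 2 r).const_sub 1
    have := (h2.rpow_const (p := p + 1) (Or.inr (by linarith))).neg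
    refine this.congr_deriv ?_
    rw [add_sub_cancel_right]
    ring
  have hint := intervalIntegral.integral_eq_sub_of_hasDerivAt (a := 0) (b := 1)
    (fun r _ => hder r)
    (((continuous_moment_integrand hp (2 * 0 + 1)).const_mul _).intervalIntegrable 0 1)
  rw [intervalIntegral.integral_const_mul] at hint
  have : (1 : ℝ) - 1 ^ 2 = 0 := by norm_num
  rw [this, Real.zero_rpow (by linarith)] at hint
  simpa [moment] using hint

/-- Parseval's formula for the weight `(1 - |z|²)^p`: the monomials are orthogonal in the weighted
Bergman space. -/
lemma lintegral_sq_eq_tsum {p : ℝ} (hp : 0 < p) {u : ℂ → ℂ} (hu : ContinuousOn u disc)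
    {c : ℕ → ℂ} (hc : ∀ z ∈ disc, HasSum (fun n => c n * z ^ n) (u z)) :
    ∫⁻ z, ‖u z‖ₑ ^ 2 * ENNReal.ofReal ((1 - ‖z‖ ^ 2) ^ p) ∂areaMeasure =
      ∑' n, ENNReal.ofReal (‖c n‖ ^ 2 * moment p n) := by
  have hpi := Real.pi_pos
  have hmeasu : Measurable (disc.indicator u) := measurable_indicator_disc hu
  have hrad : Measurable fun z : ℂ => ENNReal.ofReal ((1 - ‖z‖ ^ 2) ^ p) := by fun_prop
  have hmeas : Measurable (disc.indicator fun z =>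
      ‖u z‖ₑ ^ 2 * ENNReal.ofReal ((1 - ‖z‖ ^ 2) ^ p)) := by
    have : (disc.indicator fun z => ‖u z‖ₑ ^ 2 * ENNReal.ofReal ((1 - ‖z‖ ^ 2) ^ p)) =
        fun z => ‖disc.indicator u z‖ₑ ^ 2 * ENNReal.ofReal ((1 - ‖z‖ ^ 2) ^ p) := by
      ext z
      by_cases hz : z ∈ disc <;> simp [hz]
    rw [this]
    exact (hmeasu.enorm.pow_const 2).mul hrad
  rw [lintegral_area_polar hmeas]
  have hcirc : ∀ r ∈ Set.Ioo (0 : ℝ) 1,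
      ∫⁻ θ in Set.Ioo (-Real.pi) Real.pi, ‖u (circleMap 0 r θ)‖ₑ ^ 2 *
        ENNReal.ofReal ((1 - ‖circleMap 0 r θ‖ ^ 2) ^ p) =
      ENNReal.ofReal (2 * Real.pi) * ENNReal.ofReal ((1 - r ^ 2) ^ p) *
        ∑' n, ENNReal.ofReal (‖c n‖ ^ 2 * r ^ (2 * n)) := by
    rintro r ⟨hr0, hr1⟩
    have hs : Summable fun n => ‖c n‖ * r ^ n := by
      have := (hc (r : ℂ) (by simp [mem_disc, abs_of_pos hr0, hr1])).summable.norm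
      simpa [abs_of_pos hr0] using this
    have hsum := hasSum_sq_circleAverage hr0 hs fun z hz => hc z (by rw [mem_disc, hz]; exact hr1)
    rw [← ENNReal.ofReal_tsum_of_nonneg (fun n => by positivity) hsum.summable, hsum.tsum_eq]
    have hcont : Continuous fun θ => u (circleMap 0 r θ) :=
      hu.comp_continuous (continuous_circleMap 0 r) fun θ => by
        simp [mem_disc, abs_of_pos hr0, hr1]
    have hper : Real.circleAverage (fun z => ‖u z‖ ^ 2) 0 r =
        (2 * Real.pi)⁻¹ * ∫ θ in Set.Ioo (-Real.pi) Real.pi, ‖u (circleMap 0 r θ)‖ ^ 2 := by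
      rw [Real.circleAverage, smul_eq_mul]
      congr 1
      have hP : Function.Periodic (fun θ => ‖u (circleMap 0 r θ)‖ ^ 2) (2 * Real.pi) := by
        intro θ
        simp only
        rw [periodic_circleMap 0 r θ]
      have := hP.intervalIntegral_add_eq 0 (-Real.pi)
      rw [zero_add, show -Real.pi + 2 * Real.pi = Real.pi by ring] at this
      rw [this, intervalIntegral.integral_of_le (by linarith), integral_Ioc_eq_integral_Ioo]
    have hnorm : ∀ θ, ‖u (circleMap 0 r θ)‖ₑ ^ 2 *
        ENNReal.ofReal ((1 - ‖circleMap 0 r θ‖ ^ 2) ^ p) =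
        ENNReal.ofReal ((1 - r ^ 2) ^ p) * ENNReal.ofReal (‖u (circleMap 0 r θ)‖ ^ 2) := by
      intro θ
      rw [ENNReal.ofReal_pow (norm_nonneg _), ofReal_norm, norm_circleMap_zero, sq_abs,
        mul_comm]
    simp_rw [hnorm]
    rw [lintegral_const_mul' _ _ ENNReal.ofReal_ne_top, ← ofReal_integral_eq_lintegral_ofReal]
    · rw [hper, mul_right_comm, ← ENNReal.ofReal_mul (by positivity : 0 ≤ 2 * Real.pi), ← mul_assoc,
        mul_inv_cancel₀ (by positivity), one_mul, mul_comm]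
    · exact ((hcont.norm.pow 2).integrableOn_Icc).mono_set Set.Ioo_subset_Icc_self
    · exact Eventually.of_forall fun θ => by positivity
  rw [setLIntegral_congr_fun measurableSet_Ioo (g := fun r => ∑' n, ENNReal.ofReal Real.pi *
    (ENNReal.ofReal (‖c n‖ ^ 2) *
      ENNReal.ofReal (2 * r ^ (2 * n + 1) * (1 - r ^ 2) ^ p)))]
  · rw [lintegral_tsum (fun n => by fun_prop), ← ENNReal.tsum_mul_left]
    refine tsum_congr fun n => ?_
    rw [lintegral_const_mul' _ _ ENNReal.ofReal_ne_top,
      lintegral_const_mul' _ _ ENNReal.ofReal_ne_top, ← mul_assoc,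
      ← ENNReal.ofReal_mul (by positivity), one_div_mul_cancel hpi.ne', ENNReal.ofReal_one,
      one_mul, ENNReal.ofReal_mul (by positivity), moment,
      intervalIntegral.integral_of_le zero_le_one, integral_Ioc_eq_integral_Ioo,
      ofReal_integral_eq_lintegral_ofReal]
    · exact ((continuous_moment_integrand hp _).integrableOn_Icc).mono_set Set.Ioo_subset_Icc_self
    · filter_upwards [ae_restrict_mem measurableSet_Ioo] with r hr
      have : 0 ≤ 1 - r ^ 2 := by nlinarith [hr.1, hr.2]
      have := hr.1
      simp only [Pi.zero_apply]
      positivity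
  · intro r hr
    simp only
    rw [hcirc r hr, ← ENNReal.tsum_mul_left, ← ENNReal.tsum_mul_left]
    refine tsum_congr fun n => ?_
    have : 0 ≤ 1 - r ^ 2 := by nlinarith [hr.1, hr.2]
    have := hr.1
    rw [← ENNReal.ofReal_mul (by positivity), ← ENNReal.ofReal_mul (by positivity),
      ← ENNReal.ofReal_mul (by positivity), ← ENNReal.ofReal_mul (by positivity),
      ← ENNReal.ofReal_mul (by positivity)]
    congr 1
    ring

/-! ### A weighted Hardy inequality -/

lemma moment_le_succ {p : ℝ} (hp : 0 < p) (n : ℕ) :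
    moment p n ≤ (p + 2) * moment p (n + 1) := by
  have h1 := moment_succ hp n
  have h2 := moment_nonneg p (n + 1)
  have hn : (0 : ℝ) ≤ n := n.cast_nonneg
  have h3 : (n + 1 : ℝ) * moment p n ≤ (n + 1) * ((p + 2) * moment p (n + 1)) := by
    rw [← h1]
    nlinarith [mul_nonneg (mul_nonneg hn h2) hp.le, mul_nonneg hn h2]
  exact le_of_mul_le_mul_left h3 (by positivity)

/-- Discrete weighted Hardy inequality. The recursion of the moments reads
`p w_n = n w_(n-1) - (n+1) w_n`, so that `∑ w_n x_n²` can be summed by parts; the boundary term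
`(N+1) w_N x_N²` is what makes the induction work. -/
lemma sum_moment_mul_sq_le {p : ℝ} (hp : 0 < p) {x y : ℕ → ℝ} (hx : ∀ n, 0 ≤ x n)
    (h0 : x 0 ≤ y 0) (hxy : ∀ n, x (n + 1) ≤ x n + y (n + 1)) (N : ℕ) :
    p / 2 * ∑ n ∈ Finset.range (N + 1), x n ^ 2 * moment p n + (N + 1) * moment p N * x N ^ 2 ≤
      y 0 ^ 2 + 2 * (p + 2) / p *
        ∑ n ∈ Finset.range N, ((n + 1) * y (n + 1)) ^ 2 * moment p n := by
  induction N with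
  | zero =>
    have h1 := moment_zero hp
    have h2 : x 0 ^ 2 ≤ y 0 ^ 2 := pow_le_pow_left₀ (hx 0) h0 2
    have h3 := mul_nonneg (moment_nonneg p 0) (sq_nonneg (x 0))
    simp only [zero_add, Finset.range_one, Finset.sum_singleton, Finset.range_zero,
      Finset.sum_empty, Nat.cast_zero]
    nlinarith
  | succ N ih =>
    rw [Finset.sum_range_succ _ (N + 1),
      Finset.sum_range_succ (fun n : ℕ => ((n + 1) * y (n + 1)) ^ 2 * moment p n) N]
    have hm := moment_succ hp N
    have hle := moment_le_succ hp N
    have hw := moment_nonneg p N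
    have hw' := moment_nonneg p (N + 1)
    have hdiff : x (N + 1) ^ 2 ≤ x N ^ 2 + 2 * y (N + 1) * x (N + 1) := by
      nlinarith [sq_nonneg (x (N + 1) - x N),
        mul_nonneg (hx (N + 1)) (sub_nonneg.2 (hxy N))]
    set X := x (N + 1)
    set Y := ((N : ℝ) + 1) * y (N + 1) with hY
    have hN : (0 : ℝ) ≤ N := N.cast_nonneg
    have h1 : (N + 1 : ℝ) * moment p N * X ^ 2 ≤
        (N + 1) * moment p N * x N ^ 2 + 2 * moment p N * (Y * X) := by
      have := mul_le_mul_of_nonneg_left hdiff (mul_nonneg (by linarith : (0 : ℝ) ≤ N + 1) hw)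
      rw [hY]
      linarith
    -- Weight chosen so that, by `moment_le_succ`, the `X ^ 2` part is at most half of the gain
    -- `p * moment p (N + 1) * X ^ 2` furnished by the recursion of the moments.
    have hyoung : 2 * (Y * X) ≤ p / (2 * (p + 2)) * X ^ 2 + 2 * (p + 2) / p * Y ^ 2 := by
      have h2 : p / (2 * (p + 2)) * X ^ 2 + 2 * (p + 2) / p * Y ^ 2 - 2 * (Y * X) =
          p / (2 * (p + 2)) * (X - 2 * (p + 2) / p * Y) ^ 2 := by
        field_simp
        ring
      have h3 : 0 ≤ p / (2 * (p + 2)) * (X - 2 * (p + 2) / p * Y) ^ 2 := by positivity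
      linarith
    have h4 := mul_le_mul_of_nonneg_left hyoung hw
    have h5 : moment p N * (p / (2 * (p + 2)) * X ^ 2) ≤ p / 2 * (X ^ 2 * moment p (N + 1)) := by
      have h6 := mul_le_mul_of_nonneg_right hle
        (by positivity : 0 ≤ p / (2 * (p + 2)) * X ^ 2)
      refine h6.trans (le_of_eq ?_)
      field_simp
    have h7 : ((N : ℝ) + 1 + 1) * moment p (N + 1) * X ^ 2 + p * (X ^ 2 * moment p (N + 1)) =
        (N + 1) * moment p N * X ^ 2 := by
      rw [← hm]; ring
    push_cast
    rw [mul_add (p / 2), mul_add (2 * (p + 2) / p)]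
    linarith

lemma tsum_moment_mul_sq_le {p : ℝ} (hp : 0 < p) {x y : ℕ → ℝ} (hx : ∀ n, 0 ≤ x n)
    (h0 : x 0 ≤ y 0) (hxy : ∀ n, x (n + 1) ≤ x n + y (n + 1)) :
    ∑' n, ENNReal.ofReal (x n ^ 2 * moment p n) ≤ ENNReal.ofReal (4 * (p + 2) / p ^ 2) *
      (ENNReal.ofReal (y 0 ^ 2) +
        ∑' n : ℕ, ENNReal.ofReal (((n + 1) * y (n + 1)) ^ 2 * moment p n)) := by
  refine ENNReal.tsum_le_of_sum_range_le fun N => ?_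
  have hw := moment_nonneg p
  have hnn : ∀ n : ℕ, 0 ≤ ((n + 1 : ℝ) * y (n + 1)) ^ 2 * moment p n := fun n =>
    mul_nonneg (sq_nonneg _) (hw n)
  have key : ∑ n ∈ Finset.range N, x n ^ 2 * moment p n ≤ 4 * (p + 2) / p ^ 2 *
      (y 0 ^ 2 + ∑ n ∈ Finset.range N, ((n + 1) * y (n + 1)) ^ 2 * moment p n) := by
    have h1 := sum_moment_mul_sq_le hp hx h0 hxy N
    rw [Finset.sum_range_succ] at h1
    have h2 : 0 ≤ (N + 1) * moment p N * x N ^ 2 :=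
      mul_nonneg (mul_nonneg (by positivity) (hw N)) (sq_nonneg _)
    have h3 : 0 ≤ x N ^ 2 * moment p N := mul_nonneg (sq_nonneg _) (hw N)
    set A := ∑ n ∈ Finset.range N, x n ^ 2 * moment p n
    set B := ∑ n ∈ Finset.range N, ((n + 1 : ℝ) * y (n + 1)) ^ 2 * moment p n
    have h4 : 1 ≤ 2 * (p + 2) / p := by rw [le_div_iff₀ hp]; linarith
    have h5 : p / 2 * A ≤ 2 * (p + 2) / p * (y 0 ^ 2 + B) := by
      nlinarith [mul_nonneg (sub_nonneg.2 h4) (sq_nonneg (y 0)), mul_nonneg hp.le h3]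
    have h6 := mul_le_mul_of_nonneg_left h5 (by positivity : 0 ≤ 2 / p)
    calc A = 2 / p * (p / 2 * A) := by field_simp
      _ ≤ _ := h6
      _ = _ := by field_simp; ring
  rw [← ENNReal.ofReal_sum_of_nonneg fun n _ => mul_nonneg (sq_nonneg _) (hw n)]
  refine (ENNReal.ofReal_le_ofReal key).trans ?_
  rw [ENNReal.ofReal_mul (by positivity), ENNReal.ofReal_add (sq_nonneg _)
    (Finset.sum_nonneg fun n _ => hnn n), ENNReal.ofReal_sum_of_nonneg fun n _ => hnn n]
  gcongr
  exact ENNReal.sum_le_tsum _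

/-- The Taylor coefficients of `f` at the origin. -/
noncomputable def taylorCoeff (f : ℂ → ℂ) (n : ℕ) : ℂ := (n.factorial : ℂ)⁻¹ * iteratedDeriv n f 0

lemma hasSum_taylorCoeff {f : ℂ → ℂ} (hf : DifferentiableOn ℂ f disc) {z : ℂ} (hz : z ∈ disc) :
    HasSum (fun n => taylorCoeff f n * z ^ n) (f z) := by
  have := Complex.hasSum_taylorSeries_on_ball hf hz
  have hterm : (fun n => taylorCoeff f n * z ^ n) =
      fun n : ℕ => (n.factorial : ℂ)⁻¹ • (z - 0) ^ n • iteratedDeriv n f 0 := by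
    funext n
    rw [taylorCoeff, sub_zero, smul_eq_mul, smul_eq_mul]
    ring
  rw [hterm]
  exact this

lemma taylorCoeff_zero (f : ℂ → ℂ) : taylorCoeff f 0 = f 0 := by simp [taylorCoeff]

lemma taylorCoeff_deriv (f : ℂ → ℂ) (n : ℕ) :
    taylorCoeff (deriv f) n = (n + 1) * taylorCoeff f (n + 1) := by
  have h1 : (n.factorial : ℂ) ≠ 0 := by exact_mod_cast n.factorial_ne_zero
  have h2 : (n + 1 : ℂ) ≠ 0 := by exact_mod_cast n.succ_ne_zero
  rw [taylorCoeff, taylorCoeff, iteratedDeriv_succ', Nat.factorial_succ]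
  push_cast
  field_simp

lemma differentiableOn_deriv {f : ℂ → ℂ} (hf : DifferentiableOn ℂ f disc) :
    DifferentiableOn ℂ (deriv f) disc := hf.deriv isOpen_disc

lemma dirichletNorm_sq (p : ℝ) (f : ℂ → ℂ) : dirichletNorm p f ^ 2 =
    ‖f 0‖ₑ ^ 2 +
      ∫⁻ z, ‖deriv f z‖ₑ ^ 2 * ENNReal.ofReal ((1 - ‖z‖ ^ 2) ^ p) ∂areaMeasure := by
  rw [dirichletNorm, ← ENNReal.rpow_natCast, ← ENNReal.rpow_mul]
  norm_num

lemma dirichletNorm_sq_eq_tsum {p : ℝ} (hp : 0 < p) {f : ℂ → ℂ} (hf : DifferentiableOn ℂ f disc) :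
    dirichletNorm p f ^ 2 = ENNReal.ofReal (‖taylorCoeff f 0‖ ^ 2) +
      ∑' n : ℕ, ENNReal.ofReal (((n + 1) * ‖taylorCoeff f (n + 1)‖) ^ 2 * moment p n) := by
  rw [dirichletNorm_sq, lintegral_sq_eq_tsum hp (differentiableOn_deriv hf).continuousOn
    fun z hz => hasSum_taylorCoeff (differentiableOn_deriv hf) hz, taylorCoeff_zero,
    ENNReal.ofReal_pow (norm_nonneg _), ofReal_norm]
  congr 1
  refine tsum_congr fun n => ?_
  rw [taylorCoeff_deriv, norm_mul]
  have : ‖(n + 1 : ℂ)‖ = n + 1 := by exact_mod_cast Complex.norm_natCast (n + 1)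
  rw [this]

lemma norm_conj_mul_lt {a z : ℂ} (ha : a ∈ disc) (hz : z ∈ disc) :
    ‖(starRingEnd ℂ) a * z‖ < 1 := by
  rw [mem_disc] at ha hz
  rw [norm_mul, RCLike.norm_conj]
  nlinarith [norm_nonneg a, norm_nonneg z]

lemma one_sub_conj_mul_ne_zero {a z : ℂ} (ha : a ∈ disc) (hz : z ∈ disc) :
    1 - (starRingEnd ℂ) a * z ≠ 0 := by
  intro h
  have := norm_conj_mul_lt ha hz
  rw [← sub_eq_zero.1 h, norm_one] at this
  exact lt_irrefl _ this

/-- **Hardy's inequality** at a boundary point, in a form uniform in `a`: the measure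
`(1 - |z|²)^p |1 - conj a * z|⁻² dm(z)` is `𝒟_p`-Carleson with a constant that depends only on `p`.
The Taylor coefficients `c_n` of `h / (1 - conj a * z)` satisfy `c_(n+1) = h_(n+1) + conj a * c_n`,
which reduces this to the discrete inequality. -/
lemma lintegral_sq_div_le {p : ℝ} (hp : 0 < p) {h : ℂ → ℂ} (hh : DifferentiableOn ℂ h disc)
    {a : ℂ} (ha : a ∈ disc) :
    ∫⁻ z, ‖h z‖ₑ ^ 2 * ENNReal.ofReal ((1 - ‖z‖ ^ 2) ^ p / ‖1 - (starRingEnd ℂ) a * z‖ ^ 2)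
        ∂areaMeasure ≤
      ENNReal.ofReal (4 * (p + 2) / p ^ 2) * dirichletNorm p h ^ 2 := by
  set b := taylorCoeff h
  set α := (starRingEnd ℂ) a with hα
  have hα1 : ‖α‖ ≤ 1 := by rw [hα, RCLike.norm_conj]; exact (mem_disc.1 ha).le
  set c : ℕ → ℂ := fun n => ∑ k ∈ Finset.range (n + 1), b k * α ^ (n - k) with hcdef
  have hc0 : c 0 = b 0 := by simp [hcdef]
  have hcs : ∀ n, c (n + 1) = α * c n + b (n + 1) := by
    intro n
    simp only [hcdef]
    rw [Finset.sum_range_succ, Nat.sub_self, pow_zero, mul_one, Finset.mul_sum]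
    congr 1
    refine Finset.sum_congr rfl fun k hk => ?_
    rw [Nat.sub_add_comm (Nat.lt_succ_iff.1 (Finset.mem_range.1 hk)), pow_succ]
    ring
  have hsum : ∀ z ∈ disc, HasSum (fun n => c n * z ^ n) (h z / (1 - α * z)) := by
    intro z hz
    have h1 := hasSum_taylorCoeff hh hz
    have hlt := norm_conj_mul_lt ha hz
    have h2 := hasSum_geometric_of_norm_lt_one hlt
    have hterm : ∀ n, ∑ k ∈ Finset.range (n + 1), (b k * z ^ k) * (α * z) ^ (n - k) =
        c n * z ^ n := by
      intro n
      simp only [hcdef, Finset.sum_mul]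
      refine Finset.sum_congr rfl fun k hk => ?_
      have hk' : k ≤ n := Nat.lt_succ_iff.1 (Finset.mem_range.1 hk)
      rw [mul_pow, ← pow_sub_mul_pow z hk']
      ring
    have h3 := tsum_mul_tsum_eq_tsum_sum_range_of_summable_norm h1.summable.norm h2.summable.norm
    have h4 := (summable_norm_sum_mul_range_of_summable_norm
      h1.summable.norm h2.summable.norm).of_norm
    rw [tsum_congr hterm] at h3
    rw [funext hterm] at h4
    rw [h1.tsum_eq, h2.tsum_eq] at h3
    rw [div_eq_mul_inv, h3]
    exact h4.hasSum
  have hcont : ContinuousOn (fun z => h z / (1 - α * z)) disc :=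
    hh.continuousOn.div (by fun_prop) fun z hz => one_sub_conj_mul_ne_zero ha hz
  have hleft : ∫⁻ z, ‖h z‖ₑ ^ 2 * ENNReal.ofReal ((1 - ‖z‖ ^ 2) ^ p / ‖1 - α * z‖ ^ 2)
        ∂areaMeasure = ∫⁻ z, ‖h z / (1 - α * z)‖ₑ ^ 2 *
          ENNReal.ofReal ((1 - ‖z‖ ^ 2) ^ p) ∂areaMeasure := by
    refine area_congr fun z hz => ?_
    have hz1 := mem_disc.1 hz
    have hpos : 0 ≤ 1 - ‖z‖ ^ 2 := by nlinarith [norm_nonneg z]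
    rw [← ofReal_norm, ← ofReal_norm, ← ENNReal.ofReal_pow (norm_nonneg _),
      ← ENNReal.ofReal_pow (norm_nonneg _), ← ENNReal.ofReal_mul (by positivity),
      ← ENNReal.ofReal_mul (by positivity), norm_div]
    congr 1
    ring
  rw [hleft, lintegral_sq_eq_tsum hp hcont hsum, dirichletNorm_sq_eq_tsum hp hh]
  refine tsum_moment_mul_sq_le hp (x := fun n => ‖c n‖) (y := fun n => ‖b n‖)
    (fun n => norm_nonneg _) (by rw [hc0]) fun n => ?_
  rw [hcs]
  refine (norm_add_le _ _).trans ?_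
  rw [norm_mul]
  have := mul_le_mul_of_nonneg_right hα1 (norm_nonneg (c n))
  linarith

lemma enorm_deriv_zero_sq_le {p : ℝ} (hp : 0 < p) {h : ℂ → ℂ} (hh : DifferentiableOn ℂ h disc) :
    ‖deriv h 0‖ₑ ^ 2 ≤ ENNReal.ofReal (p + 1) * dirichletNorm p h ^ 2 := by
  rw [dirichletNorm_sq, lintegral_sq_eq_tsum hp (differentiableOn_deriv hh).continuousOn
    fun z hz => hasSum_taylorCoeff (differentiableOn_deriv hh) hz]
  have h0 := ENNReal.le_tsum (f := fun n => ENNReal.ofReal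
    (‖taylorCoeff (deriv h) n‖ ^ 2 * moment p n)) 0
  simp only [taylorCoeff_zero] at h0
  calc ‖deriv h 0‖ₑ ^ 2
      = ENNReal.ofReal (p + 1) * ENNReal.ofReal (‖deriv h 0‖ ^ 2 * moment p 0) := by
        rw [← ENNReal.ofReal_mul (by positivity), mul_left_comm, moment_zero hp, mul_one,
          ENNReal.ofReal_pow (norm_nonneg _), ofReal_norm]
    _ ≤ _ := by
        gcongr
        exact h0.trans le_add_self

/-! ### Disc automorphisms and Möbius-invariant energies -/

lemma one_sub_normSq_pos {a : ℂ} (ha : a ∈ disc) : 0 < 1 - ‖a‖ ^ 2 := by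
  rw [mem_disc] at ha
  nlinarith [norm_nonneg a]

lemma one_sub_normSq_le_one (a : ℂ) : 1 - ‖a‖ ^ 2 ≤ 1 := by nlinarith [sq_nonneg ‖a‖]

lemma norm_one_sub_conj_mul_pos {a z : ℂ} (ha : a ∈ disc) (hz : z ∈ disc) :
    0 < ‖1 - (starRingEnd ℂ) a * z‖ := norm_pos_iff.2 (one_sub_conj_mul_ne_zero ha hz)

lemma norm_one_sub_conj_mul_comm (a z : ℂ) :
    ‖1 - (starRingEnd ℂ) a * z‖ = ‖1 - (starRingEnd ℂ) z * a‖ := by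
  rw [← RCLike.norm_conj (1 - (starRingEnd ℂ) a * z)]
  simp [mul_comm]

lemma norm_one_sub_conj_mul_le_two {a z : ℂ} (ha : a ∈ disc) (hz : z ∈ disc) :
    ‖1 - (starRingEnd ℂ) a * z‖ ≤ 2 := by
  refine (norm_sub_le _ _).trans ?_
  have := norm_conj_mul_lt ha hz
  rw [norm_one]
  linarith

lemma one_sub_normSq_le {a z : ℂ} (ha : a ∈ disc) (hz : z ∈ disc) :
    1 - ‖a‖ ^ 2 ≤ 2 * ‖1 - (starRingEnd ℂ) a * z‖ := by
  have h1 : 1 - ‖(starRingEnd ℂ) a * z‖ ≤ ‖1 - (starRingEnd ℂ) a * z‖ := by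
    have := norm_sub_norm_le (1 : ℂ) ((starRingEnd ℂ) a * z)
    rwa [norm_one] at this
  rw [norm_mul, RCLike.norm_conj] at h1
  rw [mem_disc] at ha hz
  nlinarith [norm_nonneg a, norm_nonneg z]

lemma one_sub_normSq_le' {a z : ℂ} (ha : a ∈ disc) (hz : z ∈ disc) :
    1 - ‖z‖ ^ 2 ≤ 2 * ‖1 - (starRingEnd ℂ) a * z‖ := by
  rw [norm_one_sub_conj_mul_comm]
  exact one_sub_normSq_le hz ha

lemma one_sub_normSq_phi {a z : ℂ} (ha : a ∈ disc) (hz : z ∈ disc) :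
    1 - ‖phi a z‖ ^ 2 =
      (1 - ‖a‖ ^ 2) * (1 - ‖z‖ ^ 2) / ‖1 - (starRingEnd ℂ) a * z‖ ^ 2 := by
  have h := norm_one_sub_conj_mul_pos ha hz
  rw [phi, norm_div, div_pow, eq_div_iff (by positivity), sub_mul,
    div_mul_cancel₀ _ (by positivity)]
  simp only [Complex.sq_norm, Complex.normSq_apply, Complex.sub_re, Complex.sub_im,
    Complex.mul_re, Complex.mul_im, Complex.conj_re, Complex.conj_im, Complex.one_re,
    Complex.one_im]
  ring

lemma phi_mem_disc {a z : ℂ} (ha : a ∈ disc) (hz : z ∈ disc) : phi a z ∈ disc := by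
  have h := norm_one_sub_conj_mul_pos ha hz
  have h1 : 0 < 1 - ‖phi a z‖ ^ 2 := by
    rw [one_sub_normSq_phi ha hz]
    have := one_sub_normSq_pos ha
    have := one_sub_normSq_pos hz
    positivity
  rw [mem_disc]
  nlinarith [norm_nonneg (phi a z)]

lemma conj_mul_self_eq (a : ℂ) : (starRingEnd ℂ) a * a = ((‖a‖ ^ 2 : ℝ) : ℂ) := by
  rw [mul_comm, Complex.mul_conj, Complex.normSq_eq_norm_sq]

lemma one_sub_conj_mul_phi {a z : ℂ} (ha : a ∈ disc) (hz : z ∈ disc) :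
    1 - (starRingEnd ℂ) a * phi a z =
      ((1 - ‖a‖ ^ 2 : ℝ) : ℂ) / (1 - (starRingEnd ℂ) a * z) := by
  have h := one_sub_conj_mul_ne_zero ha hz
  have h2 := conj_mul_self_eq a
  rw [phi, eq_div_iff h]
  field_simp
  push_cast at h2 ⊢
  linear_combination -h2

lemma norm_one_sub_conj_mul_phi {a z : ℂ} (ha : a ∈ disc) (hz : z ∈ disc) :
    ‖1 - (starRingEnd ℂ) a * phi a z‖ = (1 - ‖a‖ ^ 2) / ‖1 - (starRingEnd ℂ) a * z‖ := by
  rw [one_sub_conj_mul_phi ha hz, norm_div, Complex.norm_real,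
    Real.norm_of_nonneg (one_sub_normSq_pos ha).le]

lemma phi_phi {a z : ℂ} (ha : a ∈ disc) (hz : z ∈ disc) : phi a (phi a z) = z := by
  have h := one_sub_conj_mul_ne_zero ha hz
  have h1 := one_sub_normSq_pos ha
  have h2 : ((1 - ‖a‖ ^ 2 : ℝ) : ℂ) ≠ 0 := by exact_mod_cast h1.ne'
  have h3 := conj_mul_self_eq a
  rw [phi, one_sub_conj_mul_phi ha hz, div_div_eq_mul_div, div_eq_iff h2, phi, sub_mul,
    div_mul_cancel₀ _ h]
  push_cast at h3 ⊢
  linear_combination -z * h3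

lemma phi_zero_right (a : ℂ) : phi a 0 = a := by simp [phi]

lemma hasDerivAt_phi {a z : ℂ} (ha : a ∈ disc) (hz : z ∈ disc) :
    HasDerivAt (phi a)
      (-((1 - ‖a‖ ^ 2 : ℝ) : ℂ) / (1 - (starRingEnd ℂ) a * z) ^ 2) z := by
  have h := one_sub_conj_mul_ne_zero ha hz
  have h1 : HasDerivAt (fun z : ℂ => a - z) (-1) z := by
    simpa using (hasDerivAt_id z).const_sub a
  have h2 : HasDerivAt (fun z : ℂ => 1 - (starRingEnd ℂ) a * z) (-(starRingEnd ℂ) a) z := by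
    simpa using ((hasDerivAt_id z).const_mul ((starRingEnd ℂ) a)).const_sub 1
  refine (h1.div h2 h).congr_deriv ?_
  have h3 := conj_mul_self_eq a
  congr 1
  push_cast at h3 ⊢
  linear_combination h3

/-- Change of variables `w = φ_a(z)`. No measurability is needed, because `φ_a` is a
diffeomorphism of the disc. -/
lemma lintegral_area_phi {a : ℂ} (ha : a ∈ disc) (F : ℂ → ℝ≥0∞) :
    ∫⁻ w, F w ∂areaMeasure = ∫⁻ z, F (phi a z) *
      ENNReal.ofReal ((1 - ‖a‖ ^ 2) ^ 2 / ‖1 - (starRingEnd ℂ) a * z‖ ^ 4) ∂areaMeasure := by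
  have himg : phi a '' disc = disc := by
    refine Set.Subset.antisymm ?_ fun z hz => ⟨phi a z, phi_mem_disc ha hz, phi_phi ha hz⟩
    rintro _ ⟨z, hz, rfl⟩
    exact phi_mem_disc ha hz
  have hinj : Set.InjOn (phi a) disc := fun z hz w hw h => by
    rw [← phi_phi ha hz, h, phi_phi ha hw]
  have hcov := lintegral_image_eq_lintegral_abs_det_fderiv_mul (volume : Measure ℂ)
    measurableSet_disc
    (fun z hz => ((hasDerivAt_phi ha hz).hasFDerivAt.restrictScalars ℝ).hasFDerivWithinAt) hinj F
  rw [himg] at hcov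
  rw [lintegral_area, lintegral_area, hcov]
  congr 1
  refine setLIntegral_congr_fun measurableSet_disc fun z hz => ?_
  have hpos := norm_one_sub_conj_mul_pos ha hz
  have h1 := one_sub_normSq_pos ha
  rw [mul_comm]
  congr 2
  have : ∀ c : ℂ, (((ContinuousLinearMap.toSpanSingleton ℂ c).restrictScalars ℝ).det : ℝ) =
      ‖c‖ ^ 2 := by
    intro c
    have : (((ContinuousLinearMap.toSpanSingleton ℂ c).restrictScalars ℝ : ℂ →L[ℝ] ℂ) :
        ℂ →ₗ[ℝ] ℂ) = ((LinearMap.toSpanSingleton ℂ ℂ c).restrictScalars ℝ) := rfl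
    rw [ContinuousLinearMap.det, this, LinearMap.det_restrictScalars]
    simp [Algebra.norm_complex_eq, Complex.normSq_eq_norm_sq]
  rw [this, abs_of_nonneg (by positivity), norm_div, norm_neg, norm_pow, Complex.norm_real,
    Real.norm_of_nonneg h1.le, div_pow, ← pow_mul]

/-- The energy `∫ |f'|² (1 - |φ_a|²)^p dm`, which is the square of the `𝒟_p` norm of
`f ∘ φ_a - f(a)`. -/
noncomputable def energy (p : ℝ) (f : ℂ → ℂ) (a : ℂ) : ℝ≥0∞ :=
  ∫⁻ w, ‖deriv f w‖ₑ ^ 2 * ENNReal.ofReal ((1 - ‖phi a w‖ ^ 2) ^ p) ∂areaMeasure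

lemma lintegral_deriv_comp_phi (p : ℝ) {f : ℂ → ℂ} (hf : DifferentiableOn ℂ f disc) {a : ℂ}
    (ha : a ∈ disc) (k : ℂ) :
    ∫⁻ z, ‖deriv (fun z => f (phi a z) - k) z‖ₑ ^ 2 *
      ENNReal.ofReal ((1 - ‖z‖ ^ 2) ^ p) ∂areaMeasure = energy p f a := by
  rw [energy, lintegral_area_phi ha (fun w =>
    ‖deriv f w‖ₑ ^ 2 * ENNReal.ofReal ((1 - ‖phi a w‖ ^ 2) ^ p))]
  refine area_congr fun z hz => ?_
  have hφ := phi_mem_disc ha hz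
  have hpos := norm_one_sub_conj_mul_pos ha hz
  have h1 := one_sub_normSq_pos ha
  have hd := ((hf.differentiableAt (isOpen_disc.mem_nhds hφ)).hasDerivAt.comp z
    (hasDerivAt_phi ha hz)).sub_const k
  have hd' : deriv (fun z => f (phi a z) - k) z =
    deriv f (phi a z) * (-((1 - ‖a‖ ^ 2 : ℝ) : ℂ) / (1 - (starRingEnd ℂ) a * z) ^ 2) := hd.deriv
  have he : ‖-((1 - ‖a‖ ^ 2 : ℝ) : ℂ) / (1 - (starRingEnd ℂ) a * z) ^ 2‖ₑ ^ 2 =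
      ENNReal.ofReal ((1 - ‖a‖ ^ 2) ^ 2 / ‖1 - (starRingEnd ℂ) a * z‖ ^ 4) := by
    rw [← ofReal_norm, ← ENNReal.ofReal_pow (norm_nonneg _), norm_div, norm_neg, norm_pow,
      Complex.norm_real, Real.norm_of_nonneg h1.le, div_pow, ← pow_mul]
  rw [hd', phi_phi ha hz, enorm_mul, mul_pow, he]
  ring

lemma dirichletNorm_hypTranslate_sq (p : ℝ) {f : ℂ → ℂ} (hf : DifferentiableOn ℂ f disc) {a : ℂ}
    (ha : a ∈ disc) : dirichletNorm p (hypTranslate f a) ^ 2 = energy p f a := by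
  rw [dirichletNorm_sq]
  unfold hypTranslate
  rw [lintegral_deriv_comp_phi p hf ha]
  simp [phi_zero_right]

lemma dirichletNorm_comp_phi_sq (p : ℝ) {f : ℂ → ℂ} (hf : DifferentiableOn ℂ f disc) {a : ℂ}
    (ha : a ∈ disc) :
    dirichletNorm p (fun z => f (phi a z)) ^ 2 = ‖f a‖ₑ ^ 2 + energy p f a := by
  have := lintegral_deriv_comp_phi p hf ha 0
  simp only [sub_zero] at this
  rw [dirichletNorm_sq, this, phi_zero_right]

lemma differentiableOn_comp_phi {f : ℂ → ℂ} (hf : DifferentiableOn ℂ f disc) {a : ℂ}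
    (ha : a ∈ disc) : DifferentiableOn ℂ (fun z => f (phi a z)) disc :=
  hf.comp (fun _ hz => (hasDerivAt_phi ha hz).differentiableAt.differentiableWithinAt)
    fun _ hz => phi_mem_disc ha hz

lemma dirichletNorm_sq_eq_energy_zero (p : ℝ) (f : ℂ → ℂ) :
    dirichletNorm p f ^ 2 = ‖f 0‖ₑ ^ 2 + energy p f 0 := by
  rw [dirichletNorm_sq, energy]
  simp [phi]

/-! ### The Dirichlet-Morrey norm and growth of its functions -/

lemma ofReal_rpow_half_sq {x s : ℝ} (hx : 0 ≤ x) :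
    ENNReal.ofReal (x ^ (s / 2)) ^ 2 = ENNReal.ofReal (x ^ s) := by
  rw [← ENNReal.ofReal_pow (Real.rpow_nonneg hx _), ← Real.rpow_natCast, ← Real.rpow_mul hx]
  norm_num

lemma morrey_term_sq {p l : ℝ} {f : ℂ → ℂ} (hf : DifferentiableOn ℂ f disc) {a : ℂ}
    (ha : a ∈ disc) :
    (ENNReal.ofReal ((1 - ‖a‖ ^ 2) ^ (p / 2 * (1 - l))) *
      dirichletNorm p (hypTranslate f a)) ^ 2 =
    ENNReal.ofReal ((1 - ‖a‖ ^ 2) ^ (p * (1 - l))) * energy p f a := by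
  rw [mul_pow, dirichletNorm_hypTranslate_sq p hf ha, ← ofReal_rpow_half_sq
    (s := p * (1 - l)) (one_sub_normSq_pos ha).le]
  congr 4
  ring

lemma ofReal_mul_energy_le {p l : ℝ} {f : ℂ → ℂ} (hf : DifferentiableOn ℂ f disc) {a : ℂ}
    (ha : a ∈ disc) :
    ENNReal.ofReal ((1 - ‖a‖ ^ 2) ^ (p * (1 - l))) * energy p f a ≤ morreyNorm p l f ^ 2 := by
  rw [← morrey_term_sq hf ha]
  gcongr
  exact (le_iSup₂ (f := fun a (_ : a ∈ disc) =>
    ENNReal.ofReal ((1 - ‖a‖ ^ 2) ^ (p / 2 * (1 - l))) * dirichletNorm p (hypTranslate f a)) a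
    ha).trans le_add_self

lemma enorm_zero_le_morreyNorm (p l : ℝ) (f : ℂ → ℂ) : ‖f 0‖ₑ ≤ morreyNorm p l f := le_self_add

lemma morreyNorm_le {p l : ℝ} {f : ℂ → ℂ} (hf : DifferentiableOn ℂ f disc) {A B : ℝ≥0∞}
    (h0 : ‖f 0‖ₑ ≤ A) (h : ∀ a ∈ disc,
      ENNReal.ofReal ((1 - ‖a‖ ^ 2) ^ (p * (1 - l))) * energy p f a ≤ B ^ 2) :
    morreyNorm p l f ≤ A + B := by
  refine add_le_add h0 (iSup₂_le fun a ha => ?_)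
  rw [← ENNReal.pow_le_pow_left_iff two_ne_zero, morrey_term_sq hf ha]
  exact h a ha

/-- The Bloch-type estimate `(1 - |a|²)^(1 + p(1-l)/2) |f'(a)| ≤ C ‖f‖`. -/
lemma norm_deriv_le_morreyNorm {p l : ℝ} (hp : 0 < p) {f : ℂ → ℂ} (hf : f ∈ morreySpace p l)
    {a : ℂ} (ha : a ∈ disc) :
    ‖deriv f a‖ ≤ Real.sqrt (p + 1) * (morreyNorm p l f).toReal *
      (1 - ‖a‖ ^ 2) ^ (-(p / 2 * (1 - l)) - 1) := by
  obtain ⟨hd, hfin⟩ := hf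
  have hM := one_sub_normSq_pos ha
  set M := 1 - ‖a‖ ^ 2 with hMdef
  have h1 := enorm_deriv_zero_sq_le hp (differentiableOn_comp_phi hd ha |>.sub_const (f a))
  have h2 : deriv (fun z => f (phi a z) - f a) 0 = deriv f a * (-(M : ℂ)) := by
    have h3 := ((hd.differentiableAt (isOpen_disc.mem_nhds (phi_mem_disc ha
      zero_mem_disc))).hasDerivAt.comp 0 (hasDerivAt_phi ha zero_mem_disc)).sub_const (f a)
    have h4 := h3.deriv
    rw [phi_zero_right, mul_zero, sub_zero, one_pow, div_one] at h4
    exact h4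
  have h3 : dirichletNorm p (fun z => f (phi a z) - f a) ^ 2 = energy p f a :=
    dirichletNorm_hypTranslate_sq p hd ha
  rw [h2, h3] at h1
  have h4 := ofReal_mul_energy_le (p := p) (l := l) hd ha
  have h5 : ENNReal.ofReal (M ^ (p * (1 - l)) * (‖deriv f a‖ * M) ^ 2) ≤
      ENNReal.ofReal ((p + 1) * (morreyNorm p l f).toReal ^ 2) := by
    rw [ENNReal.ofReal_mul (by positivity), ENNReal.ofReal_mul (by positivity),
      ENNReal.ofReal_pow ENNReal.toReal_nonneg, ENNReal.ofReal_toReal hfin.ne]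
    calc _ ≤ ENNReal.ofReal (M ^ (p * (1 - l))) * (ENNReal.ofReal (p + 1) * energy p f a) := by
          gcongr
          refine le_trans (le_of_eq ?_) h1
          rw [← ofReal_norm, norm_mul, norm_neg, Complex.norm_real, Real.norm_of_nonneg hM.le,
            ENNReal.ofReal_pow (by positivity)]
      _ = ENNReal.ofReal (p + 1) * (ENNReal.ofReal (M ^ (p * (1 - l))) * energy p f a) := by ring
      _ ≤ _ := by gcongr
  rw [ENNReal.ofReal_le_ofReal_iff (by positivity)] at h5
  have h6 : M ^ (p * (1 - l)) = (M ^ (p / 2 * (1 - l))) ^ 2 := by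
    rw [← Real.rpow_natCast, ← Real.rpow_mul hM.le]
    congr 1
    push_cast
    ring
  have h7 : M ^ (p / 2 * (1 - l)) * (‖deriv f a‖ * M) ≤
      Real.sqrt (p + 1) * (morreyNorm p l f).toReal := by
    rw [h6, ← mul_pow] at h5
    refine le_of_sq_le_sq ?_ (by positivity)
    rw [mul_pow (Real.sqrt _), Real.sq_sqrt (by positivity)]
    exact h5
  rw [Real.rpow_sub hM, Real.rpow_neg hM.le, Real.rpow_one, div_eq_mul_inv, ← mul_assoc,
    ← div_eq_mul_inv, ← div_eq_mul_inv, le_div_iff₀ hM, le_div_iff₀ (by positivity)]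
  linarith

/-- Growth of Dirichlet-Morrey functions: `|f(a)| ≤ C (1 - |a|²)^(-p(1-l)/2) ‖f‖`, by integrating
the derivative estimate along a radius. -/
lemma exists_norm_le_morreyNorm {p l : ℝ} (hp : 0 < p) (hl : l < 1) :
    ∃ C : ℝ, 0 ≤ C ∧ ∀ f ∈ morreySpace p l, ∀ a ∈ disc,
      ‖f a‖ ≤ C * (1 - ‖a‖ ^ 2) ^ (-(p / 2 * (1 - l))) * (morreyNorm p l f).toReal := by
  set σ := p / 2 * (1 - l) with hσ
  have hσ0 : 0 < σ := mul_pos (by linarith) (by linarith)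
  refine ⟨1 + Real.sqrt (p + 1) / σ * 2 ^ σ, by positivity, fun f hf a ha => ?_⟩
  have hM := one_sub_normSq_pos ha
  set N := (morreyNorm p l f).toReal with hN
  have hN0 : 0 ≤ N := ENNReal.toReal_nonneg
  have ha1 := mem_disc.1 ha
  have ha0 := norm_nonneg a
  have hmem : ∀ t ∈ Set.Icc (0 : ℝ) 1, (t : ℂ) * a ∈ disc := by
    intro t ht
    rw [mem_disc, norm_mul, Complex.norm_real, Real.norm_of_nonneg ht.1]
    nlinarith [ht.2]
  have hder : ∀ t ∈ Set.Icc (0 : ℝ) 1,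
      HasDerivAt (fun t : ℝ => f (t * a) - f 0) (deriv f (t * a) * a) t := by
    intro t ht
    have h1 : HasDerivAt (fun t : ℝ => (t : ℂ) * a) a t := by
      simpa using (Complex.ofRealCLM.hasDerivAt (x := t)).mul_const a
    have h2 := (hf.1.differentiableAt (isOpen_disc.mem_nhds (hmem t ht))).hasDerivAt
    exact (h2.comp t h1).sub_const _
  have hB : ∀ t ∈ Set.Icc (0 : ℝ) 1,
      HasDerivAt (fun t : ℝ => Real.sqrt (p + 1) * N / σ * (1 - t * ‖a‖) ^ (-σ))
        (Real.sqrt (p + 1) * N * ‖a‖ * (1 - t * ‖a‖) ^ (-σ - 1)) t := by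
    intro t ht
    have hpos : 0 < 1 - t * ‖a‖ := by nlinarith [ht.2]
    have h1 : HasDerivAt (fun t : ℝ => 1 - t * ‖a‖) (-‖a‖) t := by
      simpa using ((hasDerivAt_id t).mul_const ‖a‖).const_sub 1
    refine ((h1.rpow_const (p := -σ) (Or.inl hpos.ne')).const_mul
      (Real.sqrt (p + 1) * N / σ)).congr_deriv ?_
    field_simp
  have hmain := image_norm_le_of_norm_deriv_right_le_deriv_boundary'
    (f := fun t : ℝ => f (t * a) - f 0) (f' := fun t : ℝ => deriv f (t * a) * a)
    (B := fun t : ℝ => Real.sqrt (p + 1) * N / σ * (1 - t * ‖a‖) ^ (-σ))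
    (B' := fun t : ℝ => Real.sqrt (p + 1) * N * ‖a‖ * (1 - t * ‖a‖) ^ (-σ - 1)) (a := 0) (b := 1)
    (fun t ht => (hder t ht).continuousAt.continuousWithinAt)
    (fun t ht => (hder t (Set.Ico_subset_Icc_self ht)).hasDerivWithinAt)
    (by simp only [Complex.ofReal_zero, zero_mul, sub_self, norm_zero, sub_zero, Real.one_rpow]
        positivity)
    (fun t ht => (hB t ht).continuousAt.continuousWithinAt)
    (fun t ht => (hB t (Set.Ico_subset_Icc_self ht)).hasDerivWithinAt)
    (fun t ht => ?_) (Set.right_mem_Icc.2 zero_le_one)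
  · simp only [Complex.ofReal_one, one_mul] at hmain
    have h0 : ‖f 0‖ ≤ N := by
      rw [hN, ← toReal_enorm]
      exact ENNReal.toReal_mono hf.2.ne (enorm_zero_le_morreyNorm p l f)
    have h1 : 1 ≤ (1 - ‖a‖ ^ 2) ^ (-σ) :=
      Real.one_le_rpow_of_pos_of_le_one_of_nonpos hM (one_sub_normSq_le_one a) (by linarith)
    have h2 : (1 - ‖a‖) ^ (-σ) ≤ 2 ^ σ * (1 - ‖a‖ ^ 2) ^ (-σ) := by
      have h3 : (1 - ‖a‖) ^ (-σ) ≤ ((1 - ‖a‖ ^ 2) / 2) ^ (-σ) :=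
        Real.rpow_le_rpow_of_nonpos (by positivity) (by nlinarith) (by linarith)
      rwa [Real.div_rpow hM.le zero_le_two, Real.rpow_neg zero_le_two, div_inv_eq_mul,
        mul_comm] at h3
    calc ‖f a‖ ≤ ‖f 0‖ + ‖f a - f 0‖ := by
          have := norm_add_le (f 0) (f a - f 0)
          simpa using this
      _ ≤ N * (1 - ‖a‖ ^ 2) ^ (-σ) +
          Real.sqrt (p + 1) * N / σ * (2 ^ σ * (1 - ‖a‖ ^ 2) ^ (-σ)) := by
          refine add_le_add (h0.trans (le_mul_of_one_le_right hN0 h1)) (hmain.trans ?_)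
          gcongr
      _ = _ := by ring
  · have ht' := Set.Ico_subset_Icc_self ht
    have h1 := norm_deriv_le_morreyNorm hp hf (hmem t ht')
    have hpos : 0 < 1 - t * ‖a‖ := by nlinarith [ht'.2]
    have h2 : (1 - ‖(t : ℂ) * a‖ ^ 2) ^ (-σ - 1) ≤ (1 - t * ‖a‖) ^ (-σ - 1) := by
      refine Real.rpow_le_rpow_of_nonpos hpos ?_ (by linarith)
      rw [norm_mul, Complex.norm_real, Real.norm_of_nonneg ht'.1]
      nlinarith [mul_nonneg ht'.1 ha0]
    rw [norm_mul]
    calc ‖deriv f (t * a)‖ * ‖a‖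
        ≤ Real.sqrt (p + 1) * N * (1 - t * ‖a‖) ^ (-σ - 1) * ‖a‖ := by
          gcongr
          exact h1.trans (by gcongr)
      _ = _ := by ring

/-! ### Powers of the Cauchy kernel -/

lemma enorm_sq_eq_ofReal (x : ℂ) : ‖x‖ₑ ^ 2 = ENNReal.ofReal (‖x‖ ^ 2) := by
  rw [ENNReal.ofReal_pow (norm_nonneg _), ofReal_norm]

lemma enorm_add_sq_le (x y : ℂ) : ‖x + y‖ₑ ^ 2 ≤ 2 * ‖x‖ₑ ^ 2 + 2 * ‖y‖ₑ ^ 2 := by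
  simp_rw [enorm_sq_eq_ofReal]
  rw [show (2 : ℝ≥0∞) = ENNReal.ofReal 2 by simp, ← ENNReal.ofReal_mul zero_le_two,
    ← ENNReal.ofReal_mul zero_le_two, ← ENNReal.ofReal_add (by positivity) (by positivity)]
  refine ENNReal.ofReal_le_ofReal ?_
  nlinarith [norm_add_le x y, norm_nonneg (x + y), sq_nonneg (‖x‖ - ‖y‖)]

/-- The power `(1 - conj a * w)^(-s)` of the Cauchy kernel (principal branch). -/
noncomputable def cauchyPow (s : ℝ) (a w : ℂ) : ℂ := (1 - (starRingEnd ℂ) a * w) ^ (-s : ℂ)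

lemma one_sub_conj_mul_mem_slitPlane {a w : ℂ} (ha : a ∈ disc) (hw : w ∈ disc) :
    1 - (starRingEnd ℂ) a * w ∈ Complex.slitPlane := by
  left
  have h1 := (Complex.re_le_norm ((starRingEnd ℂ) a * w)).trans_lt (norm_conj_mul_lt ha hw)
  rw [Complex.sub_re, Complex.one_re]
  linarith

lemma cauchyPow_zero_right (s : ℝ) (a : ℂ) : cauchyPow s a 0 = 1 := by simp [cauchyPow]

lemma norm_cauchyPow (s : ℝ) (a w : ℂ) :
    ‖cauchyPow s a w‖ = ‖1 - (starRingEnd ℂ) a * w‖ ^ (-s) := by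
  rw [cauchyPow, ← Complex.ofReal_neg, Complex.norm_cpow_real]

lemma hasDerivAt_cauchyPow (s : ℝ) {a w : ℂ} (ha : a ∈ disc) (hw : w ∈ disc) :
    HasDerivAt (cauchyPow s a) (s * (starRingEnd ℂ) a * cauchyPow (s + 1) a w) w := by
  have h2 : HasDerivAt (fun z : ℂ => 1 - (starRingEnd ℂ) a * z) (-(starRingEnd ℂ) a) w := by
    simpa using ((hasDerivAt_id w).const_mul ((starRingEnd ℂ) a)).const_sub 1
  refine (h2.cpow_const (c := (-s : ℂ)) (one_sub_conj_mul_mem_slitPlane ha hw)).congr_deriv ?_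
  rw [cauchyPow, show (-((s + 1 : ℝ) : ℂ)) = -s - 1 by push_cast; ring]
  ring

lemma differentiableOn_cauchyPow (s : ℝ) {a : ℂ} (ha : a ∈ disc) :
    DifferentiableOn ℂ (cauchyPow s a) disc := fun _ hw =>
  (hasDerivAt_cauchyPow s ha hw).differentiableAt.differentiableWithinAt

lemma norm_deriv_cauchyPow_le {s : ℝ} (hs : 0 ≤ s) {a w : ℂ} (ha : a ∈ disc) (hw : w ∈ disc) :
    ‖deriv (cauchyPow s a) w‖ ≤ s * ‖1 - (starRingEnd ℂ) a * w‖ ^ (-s - 1) := by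
  have h := norm_one_sub_conj_mul_pos ha hw
  rw [(hasDerivAt_cauchyPow s ha hw).deriv, norm_mul, norm_mul, norm_cauchyPow, RCLike.norm_conj,
    Complex.norm_real, Real.norm_of_nonneg hs, show -(s + 1) = -s - 1 by ring]
  have := (mem_disc.1 ha).le
  gcongr
  exact mul_le_of_le_one_right hs this

lemma one_sub_normSq_phi_rpow (p : ℝ) {a w : ℂ} (ha : a ∈ disc) (hw : w ∈ disc) :
    (1 - ‖phi a w‖ ^ 2) ^ p =
      (1 - ‖a‖ ^ 2) ^ p * ((1 - ‖w‖ ^ 2) ^ p * ‖cauchyPow p a w‖ ^ 2) := by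
  have h := norm_one_sub_conj_mul_pos ha hw
  have h1 := one_sub_normSq_pos ha
  have h2 := one_sub_normSq_pos hw
  rw [one_sub_normSq_phi ha hw, Real.div_rpow (by positivity) (by positivity),
    Real.mul_rpow h1.le h2.le, norm_cauchyPow, Real.rpow_neg h.le, inv_pow,
    Real.rpow_pow_comm h.le, div_eq_mul_inv, mul_assoc]

/-- The measure `(1 - |φ_a|²)^p |1 - conj a * w|⁻² dm(w)` is controlled by the Möbius-invariant
energy: this is Hardy's inequality after the change of variables `w = φ_a(z)`. -/
lemma lintegral_sq_phi_div_le {p : ℝ} (hp : 0 < p) {f : ℂ → ℂ} (hf : DifferentiableOn ℂ f disc)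
    {a : ℂ} (ha : a ∈ disc) :
    ∫⁻ w, ‖f w‖ₑ ^ 2 * ENNReal.ofReal ((1 - ‖phi a w‖ ^ 2) ^ p / ‖1 - (starRingEnd ℂ) a * w‖ ^ 2)
        ∂areaMeasure ≤
      ENNReal.ofReal (4 * (p + 2) / p ^ 2) * (‖f a‖ₑ ^ 2 + energy p f a) := by
  rw [lintegral_area_phi ha, ← dirichletNorm_comp_phi_sq p hf ha]
  refine le_trans (le_of_eq ?_) (lintegral_sq_div_le hp (differentiableOn_comp_phi hf ha) ha)
  refine area_congr fun z hz => ?_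
  have h := norm_one_sub_conj_mul_pos ha hz
  have h1 := one_sub_normSq_pos ha
  have h2 := one_sub_normSq_pos hz
  rw [phi_phi ha hz, norm_one_sub_conj_mul_phi ha hz, mul_assoc,
    ← ENNReal.ofReal_mul (by positivity)]
  congr 2
  field_simp

lemma measurable_energy_integrand (p : ℝ) (f : ℂ → ℂ) (a : ℂ) :
    Measurable fun w => ‖deriv f w‖ₑ ^ 2 * ENNReal.ofReal ((1 - ‖phi a w‖ ^ 2) ^ p) := by
  have h1 : Measurable (deriv f) := measurable_deriv f
  have h2 : Measurable (phi a) := by unfold phi; fun_prop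
  fun_prop

/-- Multiplication by `(1 - |a|²)^(p/2) (1 - conj a * w)^(-p)` carries the Möbius-invariant energy
at `a` back to the norm of `𝒟_p`. -/
lemma dirichletNorm_mul_cauchyPow_le {p : ℝ} (hp : 0 < p) {f : ℂ → ℂ}
    (hf : DifferentiableOn ℂ f disc) {a : ℂ} (ha : a ∈ disc) :
    ENNReal.ofReal ((1 - ‖a‖ ^ 2) ^ p) *
        dirichletNorm p (fun w => f w * cauchyPow p a w) ^ 2 ≤
      ENNReal.ofReal (2 + 8 * (p + 2)) *
        (ENNReal.ofReal ((1 - ‖a‖ ^ 2) ^ p) * ‖f 0‖ₑ ^ 2 + ‖f a‖ₑ ^ 2 + energy p f a) := by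
  have hM := one_sub_normSq_pos ha
  set M := 1 - ‖a‖ ^ 2
  have hpt : ∀ w ∈ disc, ENNReal.ofReal (M ^ p) *
      (‖deriv (fun w => f w * cauchyPow p a w) w‖ₑ ^ 2 * ENNReal.ofReal ((1 - ‖w‖ ^ 2) ^ p)) ≤
      2 * (‖deriv f w‖ₑ ^ 2 * ENNReal.ofReal ((1 - ‖phi a w‖ ^ 2) ^ p)) +
      ENNReal.ofReal (2 * p ^ 2) * (‖f w‖ₑ ^ 2 *
        ENNReal.ofReal ((1 - ‖phi a w‖ ^ 2) ^ p / ‖1 - (starRingEnd ℂ) a * w‖ ^ 2)) := by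
    intro w hw
    have hD := norm_one_sub_conj_mul_pos ha hw
    have hW := one_sub_normSq_pos hw
    have hdf := hf.differentiableAt (isOpen_disc.mem_nhds hw)
    have hdk := (hasDerivAt_cauchyPow p ha hw).differentiableAt
    have hk := norm_deriv_cauchyPow_le hp.le ha hw
    set D := ‖1 - (starRingEnd ℂ) a * w‖
    have hkk : ‖deriv (cauchyPow p a) w‖ ^ 2 ≤ p ^ 2 * (‖cauchyPow p a w‖ ^ 2 / D ^ 2) := by
      calc _ ≤ (p * D ^ (-p - 1)) ^ 2 := by gcongr
        _ = _ := by
          rw [norm_cauchyPow, Real.rpow_sub hD, Real.rpow_one, mul_pow, div_pow]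
    rw [deriv_fun_mul hdf hdk, one_sub_normSq_phi_rpow p ha hw]
    calc _ ≤ ENNReal.ofReal (M ^ p) * ((2 * ‖deriv f w * cauchyPow p a w‖ₑ ^ 2 +
          2 * ‖f w * deriv (cauchyPow p a) w‖ₑ ^ 2) * ENNReal.ofReal ((1 - ‖w‖ ^ 2) ^ p)) := by
          gcongr
          exact enorm_add_sq_le _ _
      _ = 2 * (‖deriv f w‖ₑ ^ 2 * (ENNReal.ofReal (M ^ p) *
            (ENNReal.ofReal ((1 - ‖w‖ ^ 2) ^ p) * ‖cauchyPow p a w‖ₑ ^ 2))) +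
          ‖f w‖ₑ ^ 2 * (2 * ‖deriv (cauchyPow p a) w‖ₑ ^ 2 *
            (ENNReal.ofReal (M ^ p) * ENNReal.ofReal ((1 - ‖w‖ ^ 2) ^ p))) := by
          rw [enorm_mul, enorm_mul]
          ring
      _ ≤ _ := by
          rw [mul_left_comm (ENNReal.ofReal (2 * p ^ 2))]
          have h2 : (2 : ℝ≥0∞) = ENNReal.ofReal 2 := by simp
          refine add_le_add (mul_le_mul_right (mul_le_mul_right (le_of_eq ?_) _) _)
            (mul_le_mul_right ?_ _)
          · rw [enorm_sq_eq_ofReal (cauchyPow p a w), ← ENNReal.ofReal_mul (by positivity),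
              ← ENNReal.ofReal_mul (by positivity)]
          · rw [enorm_sq_eq_ofReal, h2, ← ENNReal.ofReal_mul (by positivity),
              ← ENNReal.ofReal_mul (by positivity), ← ENNReal.ofReal_mul (by positivity),
              ← ENNReal.ofReal_mul (by positivity)]
            refine ENNReal.ofReal_le_ofReal ?_
            calc _ ≤ 2 * (p ^ 2 * (‖cauchyPow p a w‖ ^ 2 / D ^ 2)) *
                  (M ^ p * (1 - ‖w‖ ^ 2) ^ p) := by gcongr
              _ = _ := by ring
  have hint : ENNReal.ofReal (M ^ p) * ∫⁻ w, ‖deriv (fun w => f w * cauchyPow p a w) w‖ₑ ^ 2 *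
      ENNReal.ofReal ((1 - ‖w‖ ^ 2) ^ p) ∂areaMeasure ≤
      2 * energy p f a + ENNReal.ofReal (8 * (p + 2)) * (‖f a‖ₑ ^ 2 + energy p f a) := by
    rw [← lintegral_const_mul' _ _ ENNReal.ofReal_ne_top]
    refine (area_mono hpt).trans ?_
    rw [lintegral_add_left ((measurable_energy_integrand p f a).const_mul _), lintegral_const_mul' _ _ (by simp),
      lintegral_const_mul' _ _ ENNReal.ofReal_ne_top]
    refine add_le_add le_rfl ((mul_le_mul_right (lintegral_sq_phi_div_le hp hf ha) _).trans
      (le_of_eq ?_))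
    rw [← mul_assoc, ← ENNReal.ofReal_mul (by positivity)]
    congr 2
    field_simp
    norm_num
  rw [dirichletNorm_sq, mul_add, cauchyPow_zero_right, mul_one, ENNReal.ofReal_add zero_le_two
    (by positivity)]
  have h2 : ENNReal.ofReal 2 = 2 := by simp
  rw [h2]
  calc _ ≤ ENNReal.ofReal (M ^ p) * ‖f 0‖ₑ ^ 2 +
        (2 * energy p f a + ENNReal.ofReal (8 * (p + 2)) * (‖f a‖ₑ ^ 2 + energy p f a)) := by
        gcongr
    _ ≤ 2 * (ENNReal.ofReal (M ^ p) * ‖f 0‖ₑ ^ 2) + 2 * ‖f a‖ₑ ^ 2 +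
        (2 * energy p f a + ENNReal.ofReal (8 * (p + 2)) *
          (ENNReal.ofReal (M ^ p) * ‖f 0‖ₑ ^ 2 + ‖f a‖ₑ ^ 2 + energy p f a)) := by
        gcongr
        · refine le_trans ?_ le_self_add
          exact le_mul_of_one_le_left (zero_le) one_le_two
        · exact le_add_self
    _ = _ := by ring

/-! ### Sufficient conditions -/

/-- The integral `∫ |f|² |g'|² (1 - |φ_a|²)^p dm`. -/
noncomputable def crossEnergy (p : ℝ) (f g : ℂ → ℂ) (a : ℂ) : ℝ≥0∞ :=
  ∫⁻ w, ‖f w‖ₑ ^ 2 * (‖deriv g w‖ₑ ^ 2 * ENNReal.ofReal ((1 - ‖phi a w‖ ^ 2) ^ p)) ∂areaMeasure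

lemma deriv_mulOp {f g : ℂ → ℂ} (hf : DifferentiableOn ℂ f disc) (hg : DifferentiableOn ℂ g disc)
    {w : ℂ} (hw : w ∈ disc) : deriv (mulOp g f) w = deriv g w * f w + g w * deriv f w :=
  deriv_fun_mul (hg.differentiableAt (isOpen_disc.mem_nhds hw))
    (hf.differentiableAt (isOpen_disc.mem_nhds hw))

lemma energy_mulOp_le (p : ℝ) {f g : ℂ → ℂ} (hf : DifferentiableOn ℂ f disc)
    (hg : DifferentiableOn ℂ g disc) {K : ℝ≥0} (hK : ∀ z ∈ disc, ‖g z‖ₑ ≤ K) (a : ℂ) :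
    energy p (mulOp g f) a ≤ 2 * K ^ 2 * energy p f a + 2 * crossEnergy p f g a := by
  have htop : 2 * (K : ℝ≥0∞) ^ 2 ≠ ∞ := by finiteness
  rw [energy, energy, crossEnergy, ← lintegral_const_mul' _ _ htop,
    ← lintegral_const_mul' _ _ ENNReal.ofNat_ne_top, ← lintegral_add_left
      ((measurable_energy_integrand p f a).const_mul _)]
  refine area_mono fun w hw => ?_
  rw [deriv_mulOp hf hg hw]
  calc _ ≤ (2 * ‖deriv g w * f w‖ₑ ^ 2 + 2 * ‖g w * deriv f w‖ₑ ^ 2) *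
        ENNReal.ofReal ((1 - ‖phi a w‖ ^ 2) ^ p) := by
        gcongr
        exact enorm_add_sq_le _ _
    _ = 2 * ‖g w‖ₑ ^ 2 * (‖deriv f w‖ₑ ^ 2 * ENNReal.ofReal ((1 - ‖phi a w‖ ^ 2) ^ p)) +
        2 * (‖f w‖ₑ ^ 2 * (‖deriv g w‖ₑ ^ 2 * ENNReal.ofReal ((1 - ‖phi a w‖ ^ 2) ^ p))) := by
        rw [enorm_mul, enorm_mul]
        ring
    _ ≤ _ := by
        gcongr
        exact hK w hw

lemma crossEnergy_le (p : ℝ) {f g : ℂ → ℂ} (hf : DifferentiableOn ℂ f disc)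
    (hg : DifferentiableOn ℂ g disc) {K : ℝ≥0} (hK : ∀ z ∈ disc, ‖g z‖ₑ ≤ K) (a : ℂ) :
    crossEnergy p f g a ≤ 2 * energy p (mulOp g f) a + 2 * K ^ 2 * energy p f a := by
  have htop : 2 * (K : ℝ≥0∞) ^ 2 ≠ ∞ := by finiteness
  rw [energy, energy, crossEnergy, ← lintegral_const_mul' _ _ htop,
    ← lintegral_const_mul' _ _ ENNReal.ofNat_ne_top, ← lintegral_add_left
      ((measurable_energy_integrand p _ a).const_mul _)]
  refine area_mono fun w hw => ?_
  have hsplit : deriv g w * f w = deriv (mulOp g f) w + -(g w * deriv f w) := by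
    rw [deriv_mulOp hf hg hw]
    ring
  calc _ = ‖deriv g w * f w‖ₑ ^ 2 * ENNReal.ofReal ((1 - ‖phi a w‖ ^ 2) ^ p) := by
        rw [enorm_mul]
        ring
    _ ≤ (2 * ‖deriv (mulOp g f) w‖ₑ ^ 2 + 2 * ‖g w * deriv f w‖ₑ ^ 2) *
        ENNReal.ofReal ((1 - ‖phi a w‖ ^ 2) ^ p) := by
        gcongr
        rw [hsplit]
        refine (enorm_add_sq_le _ _).trans ?_
        rw [enorm_neg]
    _ = 2 * (‖deriv (mulOp g f) w‖ₑ ^ 2 * ENNReal.ofReal ((1 - ‖phi a w‖ ^ 2) ^ p)) +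
        2 * ‖g w‖ₑ ^ 2 * (‖deriv f w‖ₑ ^ 2 * ENNReal.ofReal ((1 - ‖phi a w‖ ^ 2) ^ p)) := by
        rw [enorm_mul]
        ring
    _ ≤ _ := by
        gcongr
        exact hK w hw

lemma exists_enorm_le_of_mem_hInfty {g : ℂ → ℂ} (hg : g ∈ hInfty) :
    ∃ K : ℝ≥0, ∀ z ∈ disc, ‖g z‖ₑ ≤ K := by
  obtain ⟨_, C, hC⟩ := hg
  refine ⟨C.toNNReal, fun z hz => ?_⟩
  rw [← ofReal_norm]
  exact ENNReal.ofReal_le_ofReal (hC z hz)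

lemma differentiableOn_mulOp {f g : ℂ → ℂ} (hf : DifferentiableOn ℂ f disc)
    (hg : DifferentiableOn ℂ g disc) : DifferentiableOn ℂ (mulOp g f) disc := hg.mul hf

/-- For bounded `g`, boundedness of `M_g` follows from a Carleson-type estimate for the Morrey
functions against `|g'|² dm`. -/
lemma isBoundedMul_of_crossEnergy_le {p l : ℝ} {g : ℂ → ℂ} (hg : g ∈ hInfty) {C : ℝ≥0}
    (hC : ∀ f ∈ morreySpace p l, ∀ a ∈ disc,
      ENNReal.ofReal ((1 - ‖a‖ ^ 2) ^ (p * (1 - l))) * crossEnergy p f g a ≤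
        C * morreyNorm p l f ^ 2) : IsBoundedMul p l g := by
  obtain ⟨K, hK⟩ := exists_enorm_le_of_mem_hInfty hg
  set B := NNReal.sqrt (2 * K ^ 2 + 2 * C)
  have hB : (B : ℝ≥0∞) ^ 2 = 2 * K ^ 2 + 2 * C := by
    have : B ^ 2 = 2 * K ^ 2 + 2 * C := NNReal.sq_sqrt _
    exact_mod_cast this
  have hmain : ∀ f ∈ morreySpace p l,
      morreyNorm p l (mulOp g f) ≤ ((K + B : ℝ≥0) : ℝ≥0∞) * morreyNorm p l f := by
    intro f hf
    rw [ENNReal.coe_add, add_mul]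
    refine morreyNorm_le (differentiableOn_mulOp hf.1 hg.1) ?_ fun a ha => ?_
    · rw [mulOp, enorm_mul]
      gcongr
      · exact hK 0 zero_mem_disc
      · exact enorm_zero_le_morreyNorm p l f
    · have h1 := energy_mulOp_le p hf.1 hg.1 hK a
      have h2 := ofReal_mul_energy_le (p := p) (l := l) hf.1 ha
      have h3 := hC f hf a ha
      set m := ENNReal.ofReal ((1 - ‖a‖ ^ 2) ^ (p * (1 - l)))
      calc m * energy p (mulOp g f) a
          ≤ m * (2 * K ^ 2 * energy p f a + 2 * crossEnergy p f g a) := by gcongr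
        _ = 2 * K ^ 2 * (m * energy p f a) + 2 * (m * crossEnergy p f g a) := by ring
        _ ≤ 2 * K ^ 2 * morreyNorm p l f ^ 2 + 2 * (C * morreyNorm p l f ^ 2) := by gcongr
        _ = (B * morreyNorm p l f) ^ 2 := by rw [mul_pow, hB]; ring
  refine ⟨fun f hf => ⟨differentiableOn_mulOp hf.1 hg.1, (hmain f hf).trans_lt ?_⟩, K + B, hmain⟩
  exact ENNReal.mul_lt_top ENNReal.coe_lt_top hf.2

/-- Growth of Dirichlet-Morrey functions, in `[0, ∞]`-valued form. -/
lemma exists_enorm_sq_le_morreyNorm {p l : ℝ} (hp : 0 < p) (hl : l < 1) :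
    ∃ C : ℝ≥0, ∀ f ∈ morreySpace p l, ∀ a ∈ disc,
      ENNReal.ofReal ((1 - ‖a‖ ^ 2) ^ (p * (1 - l))) * ‖f a‖ₑ ^ 2 ≤
        C * morreyNorm p l f ^ 2 := by
  obtain ⟨C, hC0, hC⟩ := exists_norm_le_morreyNorm hp hl
  refine ⟨(C ^ 2).toNNReal, fun f hf a ha => ?_⟩
  have hM := one_sub_normSq_pos ha
  have h1 := hC f hf a ha
  have h2 : (C ^ 2).toNNReal * morreyNorm p l f ^ 2 =
      ENNReal.ofReal (C ^ 2 * (morreyNorm p l f).toReal ^ 2) := by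
    rw [ENNReal.ofReal_mul (by positivity), ENNReal.ofReal_pow ENNReal.toReal_nonneg,
      ENNReal.ofReal_toReal hf.2.ne]
    rfl
  rw [h2, enorm_sq_eq_ofReal, ← ENNReal.ofReal_mul (by positivity)]
  refine ENNReal.ofReal_le_ofReal ?_
  have h3 : (1 - ‖a‖ ^ 2) ^ (p * (1 - l)) * ((1 - ‖a‖ ^ 2) ^ (-(p / 2 * (1 - l)))) ^ 2 = 1 := by
    rw [← Real.rpow_mul_natCast hM.le, ← Real.rpow_add hM]
    convert Real.rpow_zero _ using 2
    push_cast
    ring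
  calc _ ≤ (1 - ‖a‖ ^ 2) ^ (p * (1 - l)) *
        (C * (1 - ‖a‖ ^ 2) ^ (-(p / 2 * (1 - l))) * (morreyNorm p l f).toReal) ^ 2 := by gcongr
    _ = ((1 - ‖a‖ ^ 2) ^ (p * (1 - l)) * ((1 - ‖a‖ ^ 2) ^ (-(p / 2 * (1 - l)))) ^ 2) *
        (C ^ 2 * (morreyNorm p l f).toReal ^ 2) := by ring
    _ = _ := by rw [h3, one_mul]

lemma lintegral_dirichletMeasure (p : ℝ) (g : ℂ → ℂ) (F : ℂ → ℝ≥0∞) :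
    ∫⁻ z in disc, F z ∂dirichletMeasure p g =
      ∫⁻ z, ‖deriv g z‖ₑ ^ 2 * ENNReal.ofReal ((1 - ‖z‖ ^ 2) ^ p) * F z ∂areaMeasure := by
  have hmeas : Measurable fun z => ‖deriv g z‖ₑ ^ 2 * ENNReal.ofReal ((1 - ‖z‖ ^ 2) ^ p) := by
    have h1 : Measurable (deriv g) := measurable_deriv g
    fun_prop
  rw [dirichletMeasure, setLIntegral_withDensity_eq_setLIntegral_mul_non_measurable _ hmeas _
    measurableSet_disc, Measure.restrict_eq_self_of_ae_mem ae_mem_disc]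
  · rfl
  · exact Eventually.of_forall fun z => by finiteness

/-- For `g ∈ 𝒲_p` the Carleson inequality, applied to `f (1 - conj a * w)^(-p)`, is Möbius
invariant. -/
lemma crossEnergy_le_of_isDirichletCarleson {p : ℝ} (hp : 0 < p) {f g : ℂ → ℂ}
    (hf : DifferentiableOn ℂ f disc) {C : ℝ≥0}
    (hC : ∀ h ∈ dirichletSpace p,
      ∫⁻ z in disc, ‖h z‖ₑ ^ 2 ∂dirichletMeasure p g ≤ C * dirichletNorm p h ^ 2)
    {a : ℂ} (ha : a ∈ disc) (hfin : energy p f a ≠ ∞) :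
    crossEnergy p f g a ≤ C * (ENNReal.ofReal (2 + 8 * (p + 2)) *
      (ENNReal.ofReal ((1 - ‖a‖ ^ 2) ^ p) * ‖f 0‖ₑ ^ 2 + ‖f a‖ₑ ^ 2 + energy p f a)) := by
  have hM := one_sub_normSq_pos ha
  have hF := dirichletNorm_mul_cauchyPow_le hp hf ha
  have hMp : 0 < (1 - ‖a‖ ^ 2) ^ p := by positivity
  have hmem : (fun w => f w * cauchyPow p a w) ∈ dirichletSpace p := by
    refine ⟨hf.mul (differentiableOn_cauchyPow p ha), ?_⟩
    have h1 : ENNReal.ofReal ((1 - ‖a‖ ^ 2) ^ p) *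
        dirichletNorm p (fun w => f w * cauchyPow p a w) ^ 2 < ∞ :=
      hF.trans_lt (by finiteness)
    by_contra h
    rw [not_lt_top_iff.1 h, ENNReal.top_pow two_ne_zero,
      ENNReal.mul_top (ENNReal.ofReal_pos.2 hMp).ne'] at h1
    exact lt_irrefl _ h1
  have h1 := hC _ hmem
  rw [lintegral_dirichletMeasure] at h1
  have h2 : crossEnergy p f g a = ENNReal.ofReal ((1 - ‖a‖ ^ 2) ^ p) *
      ∫⁻ z, ‖deriv g z‖ₑ ^ 2 * ENNReal.ofReal ((1 - ‖z‖ ^ 2) ^ p) *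
        ‖f z * cauchyPow p a z‖ₑ ^ 2 ∂areaMeasure := by
    rw [crossEnergy, ← lintegral_const_mul' _ _ ENNReal.ofReal_ne_top]
    refine area_congr fun w hw => ?_
    have hW := one_sub_normSq_pos hw
    rw [one_sub_normSq_phi_rpow p ha hw, ENNReal.ofReal_mul hMp.le,
      ENNReal.ofReal_mul (by positivity), ← enorm_sq_eq_ofReal, enorm_mul]
    ring
  rw [h2]
  calc _ ≤ ENNReal.ofReal ((1 - ‖a‖ ^ 2) ^ p) *
        (C * dirichletNorm p (fun w => f w * cauchyPow p a w) ^ 2) := by gcongr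
    _ = C * (ENNReal.ofReal ((1 - ‖a‖ ^ 2) ^ p) *
        dirichletNorm p (fun w => f w * cauchyPow p a w) ^ 2) := by ring
    _ ≤ _ := by gcongr

lemma energy_ne_top {p l : ℝ} {f : ℂ → ℂ} (hf : f ∈ morreySpace p l) {a : ℂ} (ha : a ∈ disc) :
    energy p f a ≠ ∞ := by
  intro h
  have h1 := ofReal_mul_energy_le (p := p) (l := l) hf.1 ha
  have hM := one_sub_normSq_pos ha
  have h2 : 0 < (1 - ‖a‖ ^ 2) ^ (p * (1 - l)) := by positivity
  rw [h, ENNReal.mul_top (ENNReal.ofReal_pos.2 h2).ne', top_le_iff] at h1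
  exact (ENNReal.pow_ne_top hf.2.ne) h1

lemma ofReal_rpow_le_one {x s : ℝ} (h0 : 0 ≤ x) (h1 : x ≤ 1) (hs : 0 ≤ s) :
    ENNReal.ofReal (x ^ s) ≤ 1 := by
  rw [← ENNReal.ofReal_one]
  exact ENNReal.ofReal_le_ofReal (Real.rpow_le_one h0 h1 hs)

theorem isBoundedMul_of_mem_wSpace {p l : ℝ} (hp : 0 < p) (hl : l < 1) {g : ℂ → ℂ}
    (hw : g ∈ wSpace p) (hb : g ∈ hInfty) : IsBoundedMul p l g := by
  obtain ⟨C, hC⟩ := hw.2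
  obtain ⟨G, hG⟩ := exists_enorm_sq_le_morreyNorm hp hl
  refine isBoundedMul_of_crossEnergy_le hb
    (C := C * (Real.toNNReal (2 + 8 * (p + 2)) * (2 + G))) fun f hf a ha => ?_
  have h1 := crossEnergy_le_of_isDirichletCarleson hp hf.1 hC ha (energy_ne_top hf ha)
  have hM := one_sub_normSq_pos ha
  have h2 := ofReal_rpow_le_one hM.le (one_sub_normSq_le_one a) hp.le
  have h3 := ofReal_rpow_le_one hM.le (one_sub_normSq_le_one a)
    (mul_nonneg hp.le (by linarith : 0 ≤ 1 - l))
  have h4 := hG f hf a ha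
  have h5 := ofReal_mul_energy_le (p := p) (l := l) hf.1 ha
  set m := ENNReal.ofReal ((1 - ‖a‖ ^ 2) ^ (p * (1 - l)))
  set N := morreyNorm p l f
  calc m * crossEnergy p f g a
      ≤ m * (C * (ENNReal.ofReal (2 + 8 * (p + 2)) *
        (ENNReal.ofReal ((1 - ‖a‖ ^ 2) ^ p) * ‖f 0‖ₑ ^ 2 + ‖f a‖ₑ ^ 2 + energy p f a))) := by
        gcongr
    _ = C * (ENNReal.ofReal (2 + 8 * (p + 2)) *
        (m * ENNReal.ofReal ((1 - ‖a‖ ^ 2) ^ p) * ‖f 0‖ₑ ^ 2 + m * ‖f a‖ₑ ^ 2 +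
          m * energy p f a)) := by ring
    _ ≤ C * (ENNReal.ofReal (2 + 8 * (p + 2)) * (1 * 1 * N ^ 2 + G * N ^ 2 + N ^ 2)) := by
        gcongr
        exact enorm_zero_le_morreyNorm p l f
    _ = _ := by
        push_cast
        rw [ENNReal.ofNNReal_toNNReal]
        ring

lemma energy_le_qNorm_sq {p : ℝ} {g : ℂ → ℂ} (hg : DifferentiableOn ℂ g disc) {a : ℂ}
    (ha : a ∈ disc) : energy p g a ≤ qNorm p g ^ 2 := by
  rw [← dirichletNorm_hypTranslate_sq p hg ha]
  gcongr
  exact (le_iSup₂ (f := fun a (_ : a ∈ disc) => dirichletNorm p (hypTranslate g a)) a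
    ha).trans le_add_self

/-- `(1 - |a|²)(1 - |φ_a(w)|²) ≤ 4 (1 - |w|²)`, in the form that trades the weight
`(1 - |φ_a|²)^p` for `(1 - |φ_a|²)^(pl)`. -/
lemma rpow_mul_one_sub_normSq_phi_le {p l : ℝ} (hp : 0 < p) (hl : l < 1) {a w : ℂ}
    (ha : a ∈ disc) (hw : w ∈ disc) :
    (1 - ‖a‖ ^ 2) ^ (p * (1 - l)) * (1 - ‖phi a w‖ ^ 2) ^ p ≤
      4 ^ (p * (1 - l)) * ((1 - ‖w‖ ^ 2) ^ (p * (1 - l)) *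
        (1 - ‖phi a w‖ ^ 2) ^ (p * l)) := by
  have hs : 0 ≤ p * (1 - l) := mul_nonneg hp.le (by linarith)
  have hM := one_sub_normSq_pos ha
  have hW := one_sub_normSq_pos hw
  have hD := norm_one_sub_conj_mul_pos ha hw
  have hP := one_sub_normSq_pos (phi_mem_disc ha hw)
  have h1 : (1 - ‖a‖ ^ 2) * (1 - ‖phi a w‖ ^ 2) ≤ 4 * (1 - ‖w‖ ^ 2) := by
    rw [one_sub_normSq_phi ha hw, ← mul_div_assoc, div_le_iff₀ (by positivity)]
    have h2 := one_sub_normSq_le ha hw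
    have h3 : (1 - ‖a‖ ^ 2) ^ 2 ≤ (2 * ‖1 - (starRingEnd ℂ) a * w‖) ^ 2 :=
      pow_le_pow_left₀ hM.le h2 2
    have h4 := mul_le_mul_of_nonneg_right h3 hW.le
    linarith
  calc _ = ((1 - ‖a‖ ^ 2) * (1 - ‖phi a w‖ ^ 2)) ^ (p * (1 - l)) *
        (1 - ‖phi a w‖ ^ 2) ^ (p * l) := by
        rw [Real.mul_rpow hM.le hP.le, mul_assoc, ← Real.rpow_add hP]
        congr 2
        ring
    _ ≤ (4 * (1 - ‖w‖ ^ 2)) ^ (p * (1 - l)) * (1 - ‖phi a w‖ ^ 2) ^ (p * l) := by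
        gcongr
    _ = _ := by rw [Real.mul_rpow (by norm_num) hW.le, mul_assoc]

theorem isBoundedMul_of_mem_qSpace {p l : ℝ} (hp : 0 < p) (hl : l < 1) {g : ℂ → ℂ}
    (hq : g ∈ qSpace (p * l)) (hb : g ∈ hInfty) : IsBoundedMul p l g := by
  obtain ⟨G, hG⟩ := exists_enorm_sq_le_morreyNorm hp hl
  set Q := (qNorm (p * l) g).toNNReal
  have hQ : (Q : ℝ≥0∞) = qNorm (p * l) g := ENNReal.coe_toNNReal hq.2.ne
  refine isBoundedMul_of_crossEnergy_le hb
    (C := Real.toNNReal (4 ^ (p * (1 - l))) * G * Q ^ 2) fun f hf a ha => ?_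
  have hN : morreyNorm p l f ^ 2 ≠ ∞ := ENNReal.pow_ne_top hf.2.ne
  have htop : ENNReal.ofReal (4 ^ (p * (1 - l))) * G * morreyNorm p l f ^ 2 ≠ ∞ := by
    finiteness
  calc _ ≤ ENNReal.ofReal (4 ^ (p * (1 - l))) * G * morreyNorm p l f ^ 2 *
        energy (p * l) g a := by
        rw [crossEnergy, energy, ← lintegral_const_mul' _ _ ENNReal.ofReal_ne_top,
          ← lintegral_const_mul' _ _ htop]
        refine area_mono fun w hw => ?_
        have hM := one_sub_normSq_pos ha
        have hW := one_sub_normSq_pos hw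
        have h1 := ENNReal.ofReal_le_ofReal (rpow_mul_one_sub_normSq_phi_le hp hl ha hw)
        rw [ENNReal.ofReal_mul (by positivity), ENNReal.ofReal_mul (by positivity),
          ENNReal.ofReal_mul (by positivity)] at h1
        calc _ = ‖f w‖ₑ ^ 2 * ‖deriv g w‖ₑ ^ 2 * (ENNReal.ofReal ((1 - ‖a‖ ^ 2) ^ (p * (1 - l))) *
              ENNReal.ofReal ((1 - ‖phi a w‖ ^ 2) ^ p)) := by ring
          _ ≤ ‖f w‖ₑ ^ 2 * ‖deriv g w‖ₑ ^ 2 * _ := mul_le_mul_right h1 _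
          _ = ENNReal.ofReal (4 ^ (p * (1 - l))) *
              (ENNReal.ofReal ((1 - ‖w‖ ^ 2) ^ (p * (1 - l))) * ‖f w‖ₑ ^ 2) *
              (‖deriv g w‖ₑ ^ 2 * ENNReal.ofReal ((1 - ‖phi a w‖ ^ 2) ^ (p * l))) := by ring
          _ ≤ ENNReal.ofReal (4 ^ (p * (1 - l))) * (G * morreyNorm p l f ^ 2) *
              (‖deriv g w‖ₑ ^ 2 * ENNReal.ofReal ((1 - ‖phi a w‖ ^ 2) ^ (p * l))) := by
              exact mul_le_mul_left (mul_le_mul_right (hG f hf w hw) _) _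
          _ = _ := by ring
    _ ≤ ENNReal.ofReal (4 ^ (p * (1 - l))) * G * morreyNorm p l f ^ 2 * Q ^ 2 := by
        gcongr
        rw [hQ]
        exact energy_le_qNorm_sq hb.1 ha
    _ = _ := by
        push_cast
        rw [ENNReal.ofNNReal_toNNReal]
        ring

/-! ### Necessary conditions -/

lemma energy_const (p : ℝ) (c a : ℂ) : energy p (fun _ => c) a = 0 := by simp [energy]

lemma one_mem_morreySpace (p l : ℝ) : (fun _ => (1 : ℂ)) ∈ morreySpace p l := by
  have hd : DifferentiableOn ℂ (fun _ : ℂ => (1 : ℂ)) disc := differentiableOn_const _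
  refine ⟨hd, (morreyNorm_le (A := 1) (B := 0) hd (by simp) fun a _ => ?_).trans_lt (by simp)⟩
  simp [energy_const]

lemma iterate_mulOp_mem {p l : ℝ} {g : ℂ → ℂ} (hg : IsBoundedMul p l g) {C : ℝ≥0}
    (hC : ∀ f ∈ morreySpace p l, morreyNorm p l (mulOp g f) ≤ C * morreyNorm p l f) (n : ℕ) :
    (fun z => g z ^ n) ∈ morreySpace p l ∧
      morreyNorm p l (fun z => g z ^ n) ≤ C ^ n * morreyNorm p l (fun _ => 1) := by
  induction n with
  | zero => simpa using one_mem_morreySpace p l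
  | succ n ih =>
    have h : (fun z => g z ^ (n + 1)) = mulOp g fun z => g z ^ n := by
      funext z
      rw [mulOp, pow_succ, mul_comm]
    rw [h]
    refine ⟨hg.1 _ ih.1, (hC _ ih.1).trans ?_⟩
    rw [pow_succ', mul_assoc]
    gcongr
    exact ih.2

/-- A multiplier is bounded: point evaluations are bounded and `g ^ n = M_g ^ n 1`, so
`|g(a)| ^ n` grows at most like `C ^ n`. -/
theorem mem_hInfty_of_isBoundedMul {p l : ℝ} (hp : 0 < p) (hl : l < 1) {g : ℂ → ℂ}
    (hd : DifferentiableOn ℂ g disc) (hg : IsBoundedMul p l g) : g ∈ hInfty := by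
  obtain ⟨C, hC⟩ := hg.2
  obtain ⟨G, hG0, hG⟩ := exists_norm_le_morreyNorm hp hl
  refine ⟨hd, C + 1, fun a ha => ?_⟩
  -- `C + 1` in place of `C` avoids a division by zero below; the sharp bound is not needed.
  by_contra! hlt
  have hC1 : (0 : ℝ) < C + 1 := by positivity
  have hone := one_mem_morreySpace p l
  set N := (morreyNorm p l fun _ => (1 : ℂ)).toReal
  set K := G * (1 - ‖a‖ ^ 2) ^ (-(p / 2 * (1 - l))) with hK
  have hM := one_sub_normSq_pos ha
  have hK0 : 0 ≤ K := by positivity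
  have hbd : ∀ n : ℕ, (‖g a‖ / (C + 1)) ^ n ≤ K * N := by
    intro n
    obtain ⟨h1, h2⟩ := iterate_mulOp_mem hg hC n
    have h3 := hG _ h1 a ha
    have h4 : (morreyNorm p l fun z => g z ^ n).toReal ≤ C ^ n * N := by
      have := ENNReal.toReal_mono
        (ENNReal.mul_ne_top (ENNReal.pow_ne_top ENNReal.coe_ne_top) hone.2.ne) h2
      simpa using this
    rw [div_pow, div_le_iff₀ (by positivity), ← norm_pow]
    calc ‖g a ^ n‖ ≤ K * (C ^ n * N) := h3.trans (by gcongr)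
      _ = K * N * C ^ n := by ring
      _ ≤ K * N * (C + 1) ^ n := by
        have hN : 0 ≤ N := ENNReal.toReal_nonneg
        gcongr
        linarith
  obtain ⟨n, hn⟩ := pow_unbounded_of_one_lt (K * N) ((one_lt_div hC1).2 hlt)
  exact absurd (hbd n) (not_le.2 hn)

/-- The functions `log (1 - conj a * w)` lie in a bounded subset of `𝒬_q`. Hardy's inequality at
`a` is applied to the function `(1 - conj b * w)^(-q)`. -/
lemma exists_lintegral_inv_sq_le {q : ℝ} (hq : 0 < q) :
    ∃ C : ℝ≥0, ∀ a ∈ disc, ∀ b ∈ disc,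
      ∫⁻ w, ENNReal.ofReal ((1 - ‖phi b w‖ ^ 2) ^ q / ‖1 - (starRingEnd ℂ) a * w‖ ^ 2)
        ∂areaMeasure ≤ C := by
  refine ⟨Real.toNNReal (4 * (q + 2) / q ^ 2) * (Real.toNNReal (2 + 8 * (q + 2)) * 2),
    fun a ha b hb => ?_⟩
  have hM := one_sub_normSq_pos hb
  have h1 := lintegral_sq_div_le hq (differentiableOn_cauchyPow q hb) ha
  have h2 := dirichletNorm_mul_cauchyPow_le (f := fun _ => 1) hq (differentiableOn_const _) hb
  simp only [one_mul, enorm_one, one_pow, mul_one, energy_const, add_zero] at h2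
  have h3 := ofReal_rpow_le_one hM.le (one_sub_normSq_le_one b) hq.le
  calc _ = ENNReal.ofReal ((1 - ‖b‖ ^ 2) ^ q) * ∫⁻ z, ‖cauchyPow q b z‖ₑ ^ 2 *
        ENNReal.ofReal ((1 - ‖z‖ ^ 2) ^ q / ‖1 - (starRingEnd ℂ) a * z‖ ^ 2) ∂areaMeasure := by
        rw [← lintegral_const_mul' _ _ ENNReal.ofReal_ne_top]
        refine area_congr fun w hw => ?_
        have hW := one_sub_normSq_pos hw
        rw [enorm_sq_eq_ofReal, ← ENNReal.ofReal_mul (by positivity),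
          ← ENNReal.ofReal_mul (by positivity), one_sub_normSq_phi_rpow q hb hw]
        congr 1
        ring
    _ ≤ ENNReal.ofReal ((1 - ‖b‖ ^ 2) ^ q) *
        (ENNReal.ofReal (4 * (q + 2) / q ^ 2) * dirichletNorm q (cauchyPow q b) ^ 2) := by
        gcongr
    _ = ENNReal.ofReal (4 * (q + 2) / q ^ 2) *
        (ENNReal.ofReal ((1 - ‖b‖ ^ 2) ^ q) * dirichletNorm q (cauchyPow q b) ^ 2) := by ring
    _ ≤ ENNReal.ofReal (4 * (q + 2) / q ^ 2) *
        (ENNReal.ofReal (2 + 8 * (q + 2)) * (1 + 1)) := by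
        exact mul_le_mul_right (h2.trans (mul_le_mul_right (add_le_add h3 le_rfl) _)) _
    _ = _ := by
        push_cast
        rw [ENNReal.ofNNReal_toNNReal, ENNReal.ofNNReal_toNNReal, one_add_one_eq_two]

/-- The functions `(1 - conj a * w)^(-p(1-l)/2)`, which have the extremal growth at `a`, are
bounded in the Dirichlet-Morrey space uniformly in `a`. -/
lemma exists_morreyNorm_cauchyPow_le {p l : ℝ} (hp : 0 < p) (hl0 : 0 < l) (hl1 : l < 1) :
    ∃ C : ℝ≥0, ∀ a ∈ disc, cauchyPow (p / 2 * (1 - l)) a ∈ morreySpace p l ∧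
      morreyNorm p l (cauchyPow (p / 2 * (1 - l)) a) ≤ C := by
  obtain ⟨Q, hQ⟩ := exists_lintegral_inv_sq_le (mul_pos hp hl0)
  set σ := p / 2 * (1 - l) with hσ
  have hσ0 : 0 ≤ σ := mul_nonneg (by linarith) (by linarith)
  set K : ℝ := 4 ^ (p * (1 - l)) * (2 ^ (p * (1 - l)) * σ ^ 2) with hK
  have hK0 : 0 ≤ K := by positivity
  set B := NNReal.sqrt (K.toNNReal * Q)
  have hmain : ∀ a ∈ disc, morreyNorm p l (cauchyPow σ a) ≤ ((1 + B : ℝ≥0) : ℝ≥0∞) := by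
    intro a ha
    rw [ENNReal.coe_add]
    refine morreyNorm_le (differentiableOn_cauchyPow σ ha) (by simp [cauchyPow_zero_right])
      fun b hb => ?_
    have hB : (B : ℝ≥0∞) ^ 2 = ENNReal.ofReal K * Q := by
      have : B ^ 2 = K.toNNReal * Q := NNReal.sq_sqrt _
      rw [← ENNReal.coe_pow, this, ENNReal.coe_mul, ENNReal.ofNNReal_toNNReal]
    rw [hB, energy, ← lintegral_const_mul' _ _ ENNReal.ofReal_ne_top]
    refine le_trans ?_ (mul_le_mul_right (hQ a ha b hb) _)
    rw [← lintegral_const_mul' _ _ ENNReal.ofReal_ne_top]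
    refine area_mono fun w hw => ?_
    have hM := one_sub_normSq_pos hb
    have hW := one_sub_normSq_pos hw
    have hP := one_sub_normSq_pos (phi_mem_disc hb hw)
    have hD := norm_one_sub_conj_mul_pos ha hw
    have h1 := rpow_mul_one_sub_normSq_phi_le hp hl1 hb hw
    have h2 := norm_deriv_cauchyPow_le hσ0 ha hw
    have h3 := one_sub_normSq_le' ha hw
    set D := ‖1 - (starRingEnd ℂ) a * w‖
    have h4 : ‖deriv (cauchyPow σ a) w‖ ^ 2 ≤ σ ^ 2 * (D ^ (-(p * (1 - l))) / D ^ 2) := by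
      calc _ ≤ (σ * D ^ (-σ - 1)) ^ 2 := by gcongr
        _ = _ := by
          rw [Real.rpow_sub hD, Real.rpow_one, mul_pow, div_pow, ← Real.rpow_mul_natCast hD.le]
          congr 4
          rw [hσ]
          push_cast
          ring
    have h5 : (1 - ‖w‖ ^ 2) ^ (p * (1 - l)) * D ^ (-(p * (1 - l))) ≤ 2 ^ (p * (1 - l)) := by
      rw [Real.rpow_neg hD.le, ← div_eq_mul_inv, div_le_iff₀ (by positivity),
        ← Real.mul_rpow zero_le_two hD.le]
      exact Real.rpow_le_rpow hW.le h3 (mul_nonneg hp.le (by linarith))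
    rw [enorm_sq_eq_ofReal, ← ENNReal.ofReal_mul (by positivity),
      ← ENNReal.ofReal_mul (by positivity), ← ENNReal.ofReal_mul hK0]
    refine ENNReal.ofReal_le_ofReal ?_
    calc _ = (1 - ‖b‖ ^ 2) ^ (p * (1 - l)) * (1 - ‖phi b w‖ ^ 2) ^ p *
          ‖deriv (cauchyPow σ a) w‖ ^ 2 := by ring
      _ ≤ 4 ^ (p * (1 - l)) * ((1 - ‖w‖ ^ 2) ^ (p * (1 - l)) * (1 - ‖phi b w‖ ^ 2) ^ (p * l)) *
          (σ ^ 2 * (D ^ (-(p * (1 - l))) / D ^ 2)) := by gcongr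
      _ = 4 ^ (p * (1 - l)) * (((1 - ‖w‖ ^ 2) ^ (p * (1 - l)) * D ^ (-(p * (1 - l)))) * σ ^ 2) *
          ((1 - ‖phi b w‖ ^ 2) ^ (p * l) / D ^ 2) := by ring
      _ ≤ _ := by
        rw [hK]
        gcongr
  exact ⟨1 + B, fun a ha => ⟨⟨differentiableOn_cauchyPow σ ha,
    (hmain a ha).trans_lt ENNReal.coe_lt_top⟩, hmain a ha⟩⟩

/-- Testing a multiplier on the functions of extremal growth. -/
lemma exists_crossEnergy_cauchyPow_le {p l : ℝ} (hp : 0 < p) (hl0 : 0 < l) (hl1 : l < 1)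
    {g : ℂ → ℂ} (hb : g ∈ hInfty) (hg : IsBoundedMul p l g) :
    ∃ C : ℝ≥0, ∀ a ∈ disc, ENNReal.ofReal ((1 - ‖a‖ ^ 2) ^ (p * (1 - l))) *
      crossEnergy p (cauchyPow (p / 2 * (1 - l)) a) g a ≤ C := by
  obtain ⟨T, hT⟩ := exists_morreyNorm_cauchyPow_le hp hl0 hl1
  obtain ⟨K, hK⟩ := exists_enorm_le_of_mem_hInfty hb
  obtain ⟨A, hA⟩ := hg.2
  refine ⟨2 * (A * T) ^ 2 + 2 * K ^ 2 * T ^ 2, fun a ha => ?_⟩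
  obtain ⟨hmem, hnorm⟩ := hT a ha
  have h1 := crossEnergy_le p hmem.1 hb.1 hK a
  have h2 := ofReal_mul_energy_le (p := p) (l := l) hmem.1 ha
  have h3 := ofReal_mul_energy_le (p := p) (l := l) (hg.1 _ hmem).1 ha
  have h4 := hA _ hmem
  set f := cauchyPow (p / 2 * (1 - l)) a
  set m := ENNReal.ofReal ((1 - ‖a‖ ^ 2) ^ (p * (1 - l)))
  calc m * crossEnergy p f g a
      ≤ m * (2 * energy p (mulOp g f) a + 2 * K ^ 2 * energy p f a) := by gcongr
    _ = 2 * (m * energy p (mulOp g f) a) + 2 * K ^ 2 * (m * energy p f a) := by ring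
    _ ≤ 2 * (A * T) ^ 2 + 2 * K ^ 2 * T ^ 2 := by
        gcongr
        · refine h3.trans ?_
          gcongr
          exact h4.trans (by gcongr)
        · refine h2.trans ?_
          gcongr
    _ = _ := by push_cast; ring

/-- Kernel estimate behind the independence of Carleson measures of the kernel exponent: with
`d = 1 - |b|` and `t_k = max(0, 1 - 2^k d)`, the kernel at `b` with exponent `2p` is dominated by the
kernels with exponent `2p + s` at the points `t_k b`, with weights `2^(-kp)`. The index that matters
for a given `w` is the one with `2^k d ≈ |1 - conj b * w|`. -/
lemma exists_kernel_le {p s : ℝ} (hp : 0 < p) (hs : 0 ≤ s) {b w : ℂ} (hb : b ∈ disc)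
    (hw : w ∈ disc) :
    ∃ k : ℕ, (1 - ‖b‖ ^ 2) ^ p * ‖1 - (starRingEnd ℂ) b * w‖ ^ (-(2 * p)) ≤
      2 ^ p * 5 ^ (2 * p + s) * ((2 : ℝ) ^ (-p)) ^ k *
        ((1 - ‖((max 0 (1 - 2 ^ k * (1 - ‖b‖)) : ℝ) : ℂ) * b‖ ^ 2) ^ (p + s) *
          ‖1 - (starRingEnd ℂ) (((max 0 (1 - 2 ^ k * (1 - ‖b‖)) : ℝ) : ℂ) * b) * w‖ ^
            (-(2 * p + s))) := by
  have hb1 := mem_disc.1 hb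
  have hw1 := mem_disc.1 hw
  have hb0 := norm_nonneg b
  set d := 1 - ‖b‖ with hd
  have hd0 : 0 < d := by linarith
  set x := ‖1 - (starRingEnd ℂ) b * w‖ with hx
  have hdx : d ≤ x := by
    have h1 := norm_sub_norm_le (1 : ℂ) ((starRingEnd ℂ) b * w)
    rw [norm_one, norm_mul, RCLike.norm_conj] at h1
    nlinarith [norm_nonneg w]
  have hx0 : 0 < x := hd0.trans_le hdx
  have hx2 : x ≤ 2 := norm_one_sub_conj_mul_le_two hb hw
  -- Truncating at `1` keeps `2 ^ k * d ≤ 1`, so the point `t_k b` is not cut off at the centre; since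
  -- `x ≤ 2`, this costs a factor of two only.
  obtain ⟨k, hk1, hk2⟩ := exists_nat_pow_near (x := min x 1 / d) (y := 2)
    (by rw [le_div_iff₀ hd0, one_mul]; exact le_min hdx (by linarith)) one_lt_two
  rw [le_div_iff₀ hd0] at hk1
  rw [div_lt_iff₀ hd0, pow_succ] at hk2
  refine ⟨k, ?_⟩
  set y := 2 ^ k * d with hy
  have hy0 : 0 < y := by positivity
  have hyx : y ≤ x := hk1.trans (min_le_left _ _)
  have hy1 : y ≤ 1 := hk1.trans (min_le_right _ _)
  have hxy : x ≤ 4 * y := by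
    rcases le_total x 1 with h | h
    · rw [min_eq_left h] at hk2; linarith
    · rw [min_eq_right h] at hk2; linarith
  rw [max_eq_right (by linarith : 0 ≤ 1 - y)]
  set c : ℂ := ((1 - y : ℝ) : ℂ) * b with hc
  have hcn : ‖c‖ = (1 - y) * ‖b‖ := by
    rw [hc, norm_mul, Complex.norm_real, Real.norm_of_nonneg (by linarith)]
  have hcd : c ∈ disc := by
    rw [mem_disc, hcn]
    nlinarith
  have hyM : y ≤ 1 - ‖c‖ ^ 2 := by
    have h1 : ‖c‖ ≤ 1 - y := by rw [hcn]; nlinarith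
    have h2 : 0 ≤ ‖c‖ := norm_nonneg c
    nlinarith
  have hDpos := norm_one_sub_conj_mul_pos hcd hw
  have hD : ‖1 - (starRingEnd ℂ) c * w‖ ≤ 5 * y := by
    have h1 : 1 - (starRingEnd ℂ) c * w =
        (1 - (starRingEnd ℂ) b * w) + (y : ℂ) * ((starRingEnd ℂ) b * w) := by
      rw [hc, map_mul, Complex.conj_ofReal]
      push_cast
      ring
    have h2 : ‖(y : ℂ) * ((starRingEnd ℂ) b * w)‖ ≤ y := by
      rw [norm_mul, Complex.norm_real, Real.norm_of_nonneg hy0.le]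
      exact mul_le_of_le_one_right hy0.le (norm_conj_mul_lt hb hw).le
    rw [h1]
    refine (norm_add_le _ _).trans ?_
    linarith
  have hMb : 1 - ‖b‖ ^ 2 ≤ 2 * d := by nlinarith
  have hMb0 := one_sub_normSq_pos hb
  have hleft : (1 - ‖b‖ ^ 2) ^ p * x ^ (-(2 * p)) ≤ (2 * d) ^ p * y ^ (-(2 * p)) := by
    have h1 := Real.rpow_le_rpow_of_nonpos hy0 hyx (by linarith : -(2 * p) ≤ 0)
    gcongr
  have hright : y ^ (p + s) * (5 * y) ^ (-(2 * p + s)) ≤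
      (1 - ‖c‖ ^ 2) ^ (p + s) * ‖1 - (starRingEnd ℂ) c * w‖ ^ (-(2 * p + s)) := by
    have h1 := Real.rpow_le_rpow_of_nonpos hDpos hD (by linarith : -(2 * p + s) ≤ 0)
    have h2 : 0 ≤ 1 - ‖c‖ ^ 2 := hy0.le.trans hyM
    gcongr
  have hpow : ((2 : ℝ) ^ (-p)) ^ k * y ^ p = d ^ p := by
    rw [hy, Real.mul_rpow (by positivity) hd0.le, Real.rpow_neg zero_le_two, inv_pow,
      Real.rpow_pow_comm zero_le_two, ← mul_assoc, inv_mul_cancel₀ (by positivity), one_mul]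
  calc _ ≤ (2 * d) ^ p * y ^ (-(2 * p)) := hleft
    _ = 2 ^ p * 5 ^ (2 * p + s) * ((2 : ℝ) ^ (-p)) ^ k *
        (y ^ (p + s) * (5 * y) ^ (-(2 * p + s))) := by
        have h5 : (5 : ℝ) ^ (2 * p + s) * 5 ^ (-(2 * p + s)) = 1 := by
          rw [← Real.rpow_add (by norm_num), add_neg_cancel, Real.rpow_zero]
        have h6 : y ^ (p + s) * y ^ (-(2 * p + s)) = y ^ p * y ^ (-(2 * p)) := by
          rw [← Real.rpow_add hy0, ← Real.rpow_add hy0]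
          congr 1
          ring
        rw [Real.mul_rpow zero_le_two hd0.le, Real.mul_rpow (by norm_num) hy0.le, ← hpow]
        calc _ = 2 ^ p * ((2 : ℝ) ^ (-p)) ^ k * (y ^ p * y ^ (-(2 * p))) := by ring
          _ = 2 ^ p * ((2 : ℝ) ^ (-p)) ^ k * (y ^ (p + s) * y ^ (-(2 * p + s))) *
              (5 ^ (2 * p + s) * 5 ^ (-(2 * p + s))) := by rw [h5, h6, mul_one]
          _ = _ := by ring
    _ ≤ _ := by gcongr

/-- The Carleson condition for the larger kernel exponent `2p + p(1-l)` gives `g ∈ 𝒬_p`. -/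
lemma exists_energy_le_of_crossEnergy_le {p l : ℝ} (hp : 0 < p) (hl1 : l < 1) {g : ℂ → ℂ}
    {C : ℝ≥0} (hC : ∀ a ∈ disc, ENNReal.ofReal ((1 - ‖a‖ ^ 2) ^ (p * (1 - l))) *
      crossEnergy p (cauchyPow (p / 2 * (1 - l)) a) g a ≤ C) :
    ∃ K : ℝ≥0, ∀ b ∈ disc, energy p g b ≤ K := by
  set s := p * (1 - l) with hs
  have hs0 : 0 ≤ s := mul_nonneg hp.le (by linarith)
  set r : ℝ := 2 ^ (-p) with hr
  have hr0 : 0 ≤ r := by positivity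
  have hr1 : r < 1 := Real.rpow_lt_one_of_one_lt_of_neg one_lt_two (by linarith)
  set A : ℝ := 2 ^ p * 5 ^ (2 * p + s) with hA
  have hA0 : 0 ≤ A := by positivity
  have hgeo : ∑' k : ℕ, ENNReal.ofReal (A * r ^ k) = ENNReal.ofReal (A * (1 - r)⁻¹) := by
    rw [← ENNReal.ofReal_tsum_of_nonneg (fun k => by positivity)
      ((summable_geometric_of_lt_one hr0 hr1).mul_left A), tsum_mul_left,
      tsum_geometric_of_lt_one hr0 hr1]
  refine ⟨(A * (1 - r)⁻¹).toNNReal * C, fun b hb => ?_⟩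
  set c : ℕ → ℂ := fun k => ((max 0 (1 - 2 ^ k * (1 - ‖b‖)) : ℝ) : ℂ) * b with hc
  have hcd : ∀ k, c k ∈ disc := by
    intro k
    have hb1 := mem_disc.1 hb
    have h2 : max 0 (1 - 2 ^ k * (1 - ‖b‖)) ≤ 1 :=
      max_le zero_le_one (by nlinarith [pow_pos (zero_lt_two (α := ℝ)) k])
    rw [mem_disc, hc, norm_mul, Complex.norm_real, Real.norm_of_nonneg (le_max_left _ _)]
    exact (mul_le_of_le_one_left (norm_nonneg b) h2).trans_lt hb1
  have hpt : ∀ w ∈ disc, ‖deriv g w‖ₑ ^ 2 * ENNReal.ofReal ((1 - ‖phi b w‖ ^ 2) ^ p) ≤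
      ∑' k, ENNReal.ofReal (A * r ^ k) * (ENNReal.ofReal ((1 - ‖c k‖ ^ 2) ^ s) *
        (ENNReal.ofReal (‖1 - (starRingEnd ℂ) (c k) * w‖ ^ (-s)) *
          (‖deriv g w‖ₑ ^ 2 * ENNReal.ofReal ((1 - ‖phi (c k) w‖ ^ 2) ^ p)))) := by
    intro w hw
    obtain ⟨k, hk⟩ := exists_kernel_le hp hs0 hb hw
    refine le_trans ?_ (ENNReal.le_tsum k)
    change _ ≤ A * r ^ k * ((1 - ‖c k‖ ^ 2) ^ (p + s) *
      ‖1 - (starRingEnd ℂ) (c k) * w‖ ^ (-(2 * p + s))) at hk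
    have hW := one_sub_normSq_pos hw
    have hM := one_sub_normSq_pos (hcd k)
    have hD := norm_one_sub_conj_mul_pos (hcd k) hw
    have hDb := norm_one_sub_conj_mul_pos hb hw
    have hP := one_sub_normSq_pos (phi_mem_disc (hcd k) hw)
    rw [mul_left_comm (ENNReal.ofReal (‖_‖ ^ _)), mul_left_comm (ENNReal.ofReal (_ ^ s)),
      mul_left_comm (ENNReal.ofReal (A * r ^ k)), ← ENNReal.ofReal_mul (by positivity),
      ← ENNReal.ofReal_mul (by positivity), ← ENNReal.ofReal_mul (by positivity)]
    refine mul_le_mul_right (ENNReal.ofReal_le_ofReal ?_) _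
    have h1 : ∀ D : ℝ, 0 < D → (D ^ (-p)) ^ 2 = D ^ (-(2 * p)) := by
      intro D hD
      rw [← Real.rpow_mul_natCast hD.le]
      congr 1
      push_cast
      ring
    rw [one_sub_normSq_phi_rpow p hb hw, one_sub_normSq_phi_rpow p (hcd k) hw, norm_cauchyPow,
      norm_cauchyPow, h1 _ hDb, h1 _ hD]
    have h2 : ‖1 - (starRingEnd ℂ) (c k) * w‖ ^ (-(2 * p + s)) =
        ‖1 - (starRingEnd ℂ) (c k) * w‖ ^ (-(2 * p)) *
          ‖1 - (starRingEnd ℂ) (c k) * w‖ ^ (-s) := by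
      rw [← Real.rpow_add hD]
      congr 1
      ring
    rw [Real.rpow_add hM, h2] at hk
    calc _ = ((1 - ‖b‖ ^ 2) ^ p * ‖1 - (starRingEnd ℂ) b * w‖ ^ (-(2 * p))) *
          (1 - ‖w‖ ^ 2) ^ p := by ring
      _ ≤ _ := mul_le_mul_of_nonneg_right hk (by positivity)
      _ = _ := by ring
  have hcross : ∀ k, ∫⁻ w, ENNReal.ofReal (‖1 - (starRingEnd ℂ) (c k) * w‖ ^ (-s)) *
      (‖deriv g w‖ₑ ^ 2 * ENNReal.ofReal ((1 - ‖phi (c k) w‖ ^ 2) ^ p)) ∂areaMeasure =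
      crossEnergy p (cauchyPow (p / 2 * (1 - l)) (c k)) g (c k) := by
    intro k
    rw [crossEnergy]
    refine area_congr fun w hw => ?_
    have hD := norm_one_sub_conj_mul_pos (hcd k) hw
    rw [enorm_sq_eq_ofReal (cauchyPow _ _ _), norm_cauchyPow, ← Real.rpow_mul_natCast hD.le]
    congr 3
    rw [hs]
    push_cast
    ring
  calc energy p g b ≤ _ := area_mono hpt
    _ = ∑' k, ENNReal.ofReal (A * r ^ k) * (ENNReal.ofReal ((1 - ‖c k‖ ^ 2) ^ s) *
        crossEnergy p (cauchyPow (p / 2 * (1 - l)) (c k)) g (c k)) := by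
        rw [lintegral_tsum]
        · refine tsum_congr fun k => ?_
          rw [lintegral_const_mul' _ _ ENNReal.ofReal_ne_top,
            lintegral_const_mul' _ _ ENNReal.ofReal_ne_top, hcross k]
        · intro k
          have h1 := measurable_energy_integrand p g (c k)
          refine Measurable.aemeasurable ?_
          refine Measurable.const_mul (Measurable.const_mul (Measurable.mul ?_ h1) _) _
          fun_prop
    _ ≤ ∑' k : ℕ, ENNReal.ofReal (A * r ^ k) * C := by
        refine ENNReal.tsum_le_tsum fun k => ?_
        gcongr
        exact hC _ (hcd k)
    _ = _ := by
        rw [ENNReal.tsum_mul_right, hgeo]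
        push_cast
        rw [ENNReal.ofNNReal_toNNReal]

lemma mem_qSpace_of_energy_le {p : ℝ} {g : ℂ → ℂ} (hg : DifferentiableOn ℂ g disc) {K : ℝ≥0}
    (hK : ∀ b ∈ disc, energy p g b ≤ K) : g ∈ qSpace p := by
  refine ⟨⟨hg, ?_⟩, ?_⟩
  · have h1 : dirichletNorm p g ^ 2 < ∞ := by
      rw [dirichletNorm_sq_eq_energy_zero]
      exact ENNReal.add_lt_top.2 ⟨by finiteness, (hK 0 zero_mem_disc).trans_lt ENNReal.coe_lt_top⟩
    simpa using h1
  · refine ENNReal.add_lt_top.2 ⟨enorm_lt_top, ?_⟩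
    refine (iSup₂_le (a := ((NNReal.sqrt K : ℝ≥0) : ℝ≥0∞)) fun a ha => ?_).trans_lt
      ENNReal.coe_lt_top
    rw [← ENNReal.pow_le_pow_left_iff two_ne_zero, dirichletNorm_hypTranslate_sq p hg ha,
      ← ENNReal.coe_pow, NNReal.sq_sqrt]
    exact hK a ha

theorem mem_qSpace_of_isBoundedMul {p l : ℝ} (hp : 0 < p) (hl0 : 0 < l) (hl1 : l < 1)
    {g : ℂ → ℂ} (hd : DifferentiableOn ℂ g disc) (hg : IsBoundedMul p l g) : g ∈ qSpace p := by
  obtain ⟨C, hC⟩ := exists_crossEnergy_cauchyPow_le hp hl0 hl1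
    (mem_hInfty_of_isBoundedMul hp hl1 hd hg) hg
  obtain ⟨K, hK⟩ := exists_energy_le_of_crossEnergy_le hp hl1 hC
  exact mem_qSpace_of_energy_le hd hK

end DirichletMorrey

theorem corollary3p5 (p l : ℝ) (hp0 : 0 < p) (hp1 : p < 1) (hl0 : 0 < l) (hl1 : l < 1)
    (g : ℂ → ℂ) (hg : DifferentiableOn ℂ g DirichletMorrey.disc) :
    (g ∈ DirichletMorrey.wSpace p ∩ DirichletMorrey.hInfty →
      DirichletMorrey.IsBoundedMul p l g) ∧
    (g ∈ DirichletMorrey.qSpace (p * l) ∩ DirichletMorrey.hInfty →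
      DirichletMorrey.IsBoundedMul p l g) ∧
    (DirichletMorrey.IsBoundedMul p l g →
      g ∈ DirichletMorrey.qSpace p ∩ DirichletMorrey.hInfty) := by
  refine ⟨fun h => ?_, fun h => ?_, fun h => ⟨?_, ?_⟩⟩
  · exact DirichletMorrey.isBoundedMul_of_mem_wSpace hp0 hl1 h.1 h.2
  · exact DirichletMorrey.isBoundedMul_of_mem_qSpace hp0 hl1 h.1 h.2
  · exact DirichletMorrey.mem_qSpace_of_isBoundedMul hp0 hl0 hl1 hg h
  · exact DirichletMorrey.mem_hInfty_of_isBoundedMul hp0 hl1 hg h
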